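/- Let $d\ge 1$ be an integer. Write $|\cdot|$ for Lebesgue measure on $\mathbb R^d$. We use the following definitions. **Bounded variation.** For $u\in L^1(\mathbb R^d)$ let $\|Du\|=\sup\{\int u\,\mathrm{div}\,v : v\in C^1_c(\mathbb R^d;\mathbb R^d),\ |v|\le 1\}$. The space $BV([0,1]^d)$ consists of the (classes of) $u\in L^1(\mathbb R^d)$ that vanish a.e. outside $[0,1]^d$ and satisfy $\|Du\|<\infty$. Its norm is $\|u\|_{BV}=\|u\|_1+\|Du\|$. Let $\mathcal{BV}([0,1]^d)$ be the collection of Lebesgue measurable sets $B\subset[0,1]^d$ with finite perimeter $\|B\|=\|D\mathbf 1_B\|$. **Charges.** A *charge* on $[0,1]^d$ is a function $\mu:\mathcal{BV}([0,1]^d)\to\mathbb R$ with the following two properties. It is finitely additive: $\mu(B_1\cup B_2)=\mu(B_1)+\mu(B_2)$ if $|B_1\cap B_2|=0$. It is continuous: $\mu(B_n)\to\mu(B)$ whenever $B_n, B\in\mathcal{BV}([0,1]^d)$, $\sup_n\|B_n\|<\infty$ and $|B_n\triangle B|\to 0$. Let $SCH([0,1]^d)$ be the closure, in the dual Banach space $BV([0,1]^d)^*$,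 of the set of functionals $u\mapsto\int_{[0,1]^d} g\,u$ with $g\in L^d([0,1]^d)$. A charge $\mu$ is *strong* if there is $\alpha\in SCH([0,1]^d)$ with $\mu(B)=\alpha(\mathbf 1_B)$ for all $B\in\mathcal{BV}([0,1]^d)$. **Increments.** Let $C_0([0,1]^d)$ be the set of continuous $f:[0,1]^d\to\mathbb R$ with $f(x)=0$ whenever some coordinate $x_i$ is $0$. For a rectangle $K=\prod_i[a_i,b_i]\subset[0,1]^d$ (with $a_i<b_i$) put $$\Delta_f(K)=\sum_{c\in\prod_i\{a_i,b_i\}}(-1)^{\#\{i\,:\,c_i=a_i\}}f(c).$$ Extend $\Delta_f$ additively to figures, that is, finite unions of rectangles contained in $[0,1]^d$: $\Delta_f\big(\bigcup_j K_j\big)=\sum_j\Delta_f(K_j)$ for finitely many rectangles $K_j$ that are pairwise almost disjoint, i.e. $|K_j\cap K_l|=0$ for $j\ne l$. **Hölder strong chargeability.** A *dyadic cube* is a set $\prod_i[2^{-n}k_i,2^{-n}(k_i+1)]$ with $n\ge 0$ and integers $0\le k_i\le 2^n-1$. For $\frac{d-1}{d}<\gamma<1$, $f\in C_0([0,1]^d)$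 is *$\gamma$-Hölder strongly chargeable* if $\Delta_f$ extends from figures to a strong charge $\mu$ on $[0,1]^d$ for which there is a constant $C'\ge 0$ with $|\mu(K)|\le C'|K|^\gamma$ for all dyadic cubes $K$. **Proposition.** Let $f\in C_0([0,1]^d)$ and $\frac{d-1}{d}<\gamma<1$. Suppose that there is a constant $C\ge 0$ such that $|\Delta_f(K)|\le C|K|^\gamma$ for all dyadic cubes $K$. Then $f$ is $\gamma$-Hölder strongly chargeable. -/

import Mathlib

open MeasureTheory Filter Topology
open scoped ENNReal

noncomputable section

namespace StrongCharge

/-- The ambient space `ℝ^d` with its Euclidean norm. -/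
abbrev E (d : ℕ) : Type := EuclideanSpace ℝ (Fin d)

/-- The closed box `∏ [a i, b i]`. -/
def box {d : ℕ} (a b : Fin d → ℝ) : Set (E d) := {x | ∀ i, a i ≤ x i ∧ x i ≤ b i}

/-- The unit cube `[0,1]^d`. -/
def unitCube (d : ℕ) : Set (E d) := box (fun _ => 0) (fun _ => 1)

/-! ### Functions of bounded variation -/

/-- The divergence of a vector field. -/
def divergence {d : ℕ} (v : E d → E d) (x : E d) : ℝ :=
  ∑ i, (fderiv ℝ v x (EuclideanSpace.single i 1)) i

/-- Compactly supported `C¹` vector fields of Euclidean norm at most `1`. -/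
def IsTestField {d : ℕ} (v : E d → E d) : Prop :=
  ContDiff ℝ 1 v ∧ HasCompactSupport v ∧ ∀ x, ‖v x‖ ≤ 1

/-- The variation `‖Du‖(ℝ^d)` of an integrable function `u`. (The supremum is nonnegative because
the zero field is a test field, so truncating at `0` does not change it.) -/
def variation {d : ℕ} (u : E d → ℝ) : ℝ≥0∞ :=
  ⨆ (v : E d → E d) (_ : IsTestField v), ENNReal.ofReal (∫ x, u x * divergence v x)

theorem variation_congr {d : ℕ} {u w : E d → ℝ} (h : u =ᵐ[volume] w) :
    variation u = variation w := by
  unfold variation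
  refine iSup_congr fun v => iSup_congr fun _ => ?_
  congr 1
  refine integral_congr_ae ?_
  filter_upwards [h] with x hx
  rw [hx]

theorem IsTestField.neg {d : ℕ} {v : E d → E d} (hv : IsTestField v) :
    IsTestField (fun x => -v x) :=
  ⟨hv.1.neg, hv.2.1.neg, fun x => by rw [norm_neg]; exact hv.2.2 x⟩

theorem divergence_neg {d : ℕ} (v : E d → E d) (x : E d) :
    divergence (fun y => -v y) x = -divergence v x := by
  simp [divergence, fderiv_fun_neg]

theorem IsTestField.integrable_mul {d : ℕ} {v : E d → E d} (hv : IsTestField v)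
    {u : E d → ℝ} (hu : Integrable u volume) :
    Integrable (fun x => u x * divergence v x) volume := by
  have hcf : Continuous (fderiv ℝ v) := hv.1.continuous_fderiv one_ne_zero
  have hc : Continuous (divergence v) := by
    unfold divergence
    fun_prop
  have hs : HasCompactSupport (divergence v) := by
    refine (hv.2.1.fderiv ℝ).mono fun x hx => ?_
    simp only [Function.mem_support] at hx ⊢
    intro h
    exact hx (by simp [divergence, h])
  obtain ⟨M, hM⟩ := hc.bounded_above_of_compact_support hs
  exact hu.mul_bdd hc.aestronglyMeasurable (Eventually.of_forall hM)

theorem variation_add_le {d : ℕ} {u w : E d → ℝ} (hu : Integrable u volume)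
    (hw : Integrable w volume) : variation (u + w) ≤ variation u + variation w := by
  refine iSup₂_le fun v hv => ?_
  have : ∫ x, (u + w) x * divergence v x
      = (∫ x, u x * divergence v x) + ∫ x, w x * divergence v x := by
    rw [← integral_add (hv.integrable_mul hu) (hv.integrable_mul hw)]
    congr 1
    funext x
    simp [add_mul]
  rw [this]
  refine ENNReal.ofReal_add_le.trans (add_le_add ?_ ?_)
  · exact le_iSup₂ (f := fun (v : E d → E d) (_ : IsTestField v) =>
      ENNReal.ofReal (∫ x, u x * divergence v x)) v hv
  · exact le_iSup₂ (f := fun (v : E d → E d) (_ : IsTestField v) =>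
      ENNReal.ofReal (∫ x, w x * divergence v x)) v hv

theorem variation_smul_le {d : ℕ} (c : ℝ) (u : E d → ℝ) :
    variation (c • u) ≤ ENNReal.ofReal |c| * variation u := by
  refine iSup₂_le fun v hv => ?_
  have h1 : ∫ x, (c • u) x * divergence v x = c * ∫ x, u x * divergence v x := by
    rw [← integral_const_mul]
    congr 1
    funext x
    simp [mul_assoc]
  rw [h1]
  rcases le_total 0 c with hc | hc
  · rw [abs_of_nonneg hc, ENNReal.ofReal_mul hc]
    gcongr
    exact le_iSup₂ (f := fun (v : E d → E d) (_ : IsTestField v) =>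
      ENNReal.ofReal (∫ x, u x * divergence v x)) v hv
  · have h2 : c * ∫ x, u x * divergence v x
        = (-c) * ∫ x, u x * divergence (fun y => -v y) x := by
      simp only [divergence_neg, mul_neg, integral_neg]
      ring
    rw [h2, abs_of_nonpos hc, ENNReal.ofReal_mul (neg_nonneg.2 hc)]
    gcongr
    exact le_iSup₂ (f := fun (v : E d → E d) (_ : IsTestField v) =>
      ENNReal.ofReal (∫ x, u x * divergence v x)) _ hv.neg

theorem variation_zero {d : ℕ} : variation (0 : E d → ℝ) = 0 := by
  simp [variation]

/-- The integrable functions on `ℝ^d` (modulo equality almost everywhere) that vanish almost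
everywhere outside `[0,1]^d` and have finite variation on `ℝ^d`, as a linear subspace of `L¹`. -/
def bvSubmodule (d : ℕ) : Submodule ℝ (Lp ℝ 1 (volume : Measure (E d))) where
  carrier := {u | (∀ᵐ x, x ∉ unitCube d → u x = 0) ∧ variation (u : E d → ℝ) < ⊤}
  zero_mem' := by
    refine ⟨?_, ?_⟩
    · filter_upwards [Lp.coeFn_zero ℝ 1 (volume : Measure (E d))] with x hx _
      exact hx
    · rw [variation_congr (Lp.coeFn_zero ℝ 1 (volume : Measure (E d))), variation_zero]
      exact ENNReal.zero_lt_top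
  add_mem' := by
    rintro u w ⟨hu, hu'⟩ ⟨hw, hw'⟩
    refine ⟨?_, ?_⟩
    · filter_upwards [Lp.coeFn_add u w, hu, hw] with x hx h1 h2 hxc
      rw [hx, Pi.add_apply, h1 hxc, h2 hxc, add_zero]
    · rw [variation_congr (Lp.coeFn_add u w)]
      exact (variation_add_le (L1.integrable_coeFn u) (L1.integrable_coeFn w)).trans_lt
        (ENNReal.add_lt_top.2 ⟨hu', hw'⟩)
  smul_mem' := by
    rintro c u ⟨hu, hu'⟩
    refine ⟨?_, ?_⟩
    · filter_upwards [Lp.coeFn_smul c u, hu] with x hx h1 hxc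
      rw [hx, Pi.smul_apply, h1 hxc, smul_zero]
    · rw [variation_congr (Lp.coeFn_smul c u)]
      exact (variation_smul_le c u).trans_lt (ENNReal.mul_lt_top ENNReal.ofReal_lt_top hu')

/-- The space `BV([0,1]^d)`. It is a type of its own because it carries the `BV` norm and not the
norm of `L¹`. -/
def BV (d : ℕ) : Type := bvSubmodule d

namespace BV

instance (d : ℕ) : AddCommGroup (BV d) := inferInstanceAs (AddCommGroup (bvSubmodule d))

instance (d : ℕ) : Module ℝ (BV d) := inferInstanceAs (Module ℝ (bvSubmodule d))

/-- The underlying element of `L¹`. -/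
def toL1 {d : ℕ} : BV d →ₗ[ℝ] Lp ℝ 1 (volume : Measure (E d)) := (bvSubmodule d).subtype

theorem toL1_injective {d : ℕ} : Function.Injective (toL1 (d := d)) :=
  Submodule.subtype_injective (bvSubmodule d)

theorem variation_lt_top {d : ℕ} (u : BV d) : variation (toL1 u : E d → ℝ) < ⊤ :=
  (show bvSubmodule d from u).2.2

/-- The norm `‖u‖_BV = ‖u‖₁ + ‖Du‖(ℝ^d)`. -/
def bvNorm {d : ℕ} (u : BV d) : ℝ := ‖toL1 u‖ + (variation (toL1 u : E d → ℝ)).toReal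

theorem bvNorm_smul_le {d : ℕ} (c : ℝ) (u : BV d) : bvNorm (c • u) ≤ ‖c‖ * bvNorm u := by
  rw [bvNorm, bvNorm, mul_add, map_smul, norm_smul]
  refine add_le_add le_rfl ?_
  rw [variation_congr (Lp.coeFn_smul c (toL1 u))]
  have h := ENNReal.toReal_mono
    (ENNReal.mul_lt_top ENNReal.ofReal_lt_top (variation_lt_top u)).ne
    (variation_smul_le c (toL1 u : E d → ℝ))
  rwa [ENNReal.toReal_mul, ENNReal.toReal_ofReal (abs_nonneg c)] at h

/-- The `BV` norm as a group norm. -/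
def groupNorm (d : ℕ) : AddGroupNorm (BV d) where
  toFun := bvNorm
  map_zero' := by
    rw [bvNorm, map_zero, variation_congr (Lp.coeFn_zero ℝ 1 (volume : Measure (E d))),
      variation_zero]
    simp
  add_le' u w := by
    rw [bvNorm, bvNorm, bvNorm, map_add,
      variation_congr (Lp.coeFn_add (toL1 u) (toL1 w))]
    have h1 := norm_add_le (toL1 u) (toL1 w)
    have h2 := ENNReal.toReal_mono
      (ENNReal.add_lt_top.2 ⟨variation_lt_top u, variation_lt_top w⟩).ne
      (variation_add_le (L1.integrable_coeFn (toL1 u)) (L1.integrable_coeFn (toL1 w)))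
    rw [ENNReal.toReal_add (variation_lt_top u).ne (variation_lt_top w).ne] at h2
    linarith
  neg' u := by
    have h1 := bvNorm_smul_le (-1) u
    have h2 := bvNorm_smul_le (-1) (-u)
    simp only [neg_smul, one_smul, neg_neg, norm_neg, norm_one, one_mul] at h1 h2
    exact le_antisymm h1 h2
  eq_zero_of_map_eq_zero' u hu := by
    rw [bvNorm] at hu
    have h1 : ‖toL1 u‖ = 0 :=
      le_antisymm (by linarith [ENNReal.toReal_nonneg (a := variation (toL1 u : E d → ℝ))])
        (norm_nonneg _)
    exact toL1_injective ((norm_eq_zero.1 h1).trans (map_zero toL1).symm)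

instance (d : ℕ) : NormedAddCommGroup (BV d) := (groupNorm d).toNormedAddCommGroup

theorem norm_def {d : ℕ} (u : BV d) :
    ‖u‖ = ‖toL1 u‖ + (variation (toL1 u : E d → ℝ)).toReal := rfl

instance (d : ℕ) : NormedSpace ℝ (BV d) where
  norm_smul_le := bvNorm_smul_le

end BV

/-! ### `BV`-sets and charges -/

/-- The perimeter `‖A‖ = ‖D 1_A‖(ℝ^d)`. -/
def perimeter {d : ℕ} (A : Set (E d)) : ℝ≥0∞ := variation (A.indicator (fun _ => (1 : ℝ)))

/-- `B` belongs to `𝓑𝓥([0,1]^d)`: it is a (Lebesgue) measurable subset of `[0,1]^d` of finite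
perimeter. -/
structure IsBVSet {d : ℕ} (B : Set (E d)) : Prop where
  subset : B ⊆ unitCube d
  measurable : NullMeasurableSet B volume
  perimeter_lt_top : perimeter B < ⊤

/-- Charges on `[0,1]^d`. Only the values of `μ` on `𝓑𝓥([0,1]^d)` matter. -/
structure IsCharge {d : ℕ} (μ : Set (E d) → ℝ) : Prop where
  /-- finite additivity -/
  additive : ∀ B₁ B₂ : Set (E d), IsBVSet B₁ → IsBVSet B₂ → volume (B₁ ∩ B₂) = 0 →
    μ (B₁ ∪ B₂) = μ B₁ + μ B₂
  /-- continuity with respect to `BV`-convergence -/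
  continuous : ∀ (B : ℕ → Set (E d)) (B' : Set (E d)), (∀ n, IsBVSet (B n)) → IsBVSet B' →
    ⨆ n, perimeter (B n) < ⊤ →
    Tendsto (fun n => volume (symmDiff (B n) B')) atTop (𝓝 0) →
    Tendsto (fun n => μ (B n)) atTop (𝓝 (μ B'))

theorem volume_unitCube_lt_top (d : ℕ) : volume (unitCube d) < ⊤ := by
  have hb : Bornology.IsBounded (unitCube d) := by
    refine (Metric.isBounded_closedBall (x := (0 : E d)) (r := d)).subset fun x hx => ?_
    rw [mem_closedBall_zero_iff]
    refine (EuclideanSpace.norm_eq x).trans_le ?_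
    rw [Real.sqrt_le_left (Nat.cast_nonneg d)]
    calc ∑ i, ‖x i‖ ^ 2 ≤ ∑ _i : Fin d, (1 : ℝ) := by
          refine Finset.sum_le_sum fun i _ => ?_
          rw [Real.norm_eq_abs, sq_abs]
          have := hx i
          nlinarith [this.1, this.2]
      _ = d := by simp
      _ ≤ (d : ℝ) ^ 2 := by
          exact_mod_cast Nat.le_self_pow two_ne_zero d
  exact hb.measure_lt_top

theorem IsBVSet.memLp {d : ℕ} {B : Set (E d)} (hB : IsBVSet B) :
    MemLp (B.indicator (fun _ => (1 : ℝ))) 1 volume := by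
  rw [memLp_one_iff_integrable]
  refine IntegrableOn.integrable_indicator₀ (integrableOn_const ?_) hB.measurable
  exact ((measure_mono hB.subset).trans_lt (volume_unitCube_lt_top d)).ne

/-- The indicator function `1_B` of a `BV`-set as an element of `BV([0,1]^d)`. -/
def IsBVSet.indicator {d : ℕ} {B : Set (E d)} (hB : IsBVSet B) : BV d :=
  (⟨hB.memLp.toLp _, by
    refine ⟨?_, ?_⟩
    · filter_upwards [hB.memLp.coeFn_toLp] with x hx hxc
      rw [hx, Set.indicator_of_notMem (fun h => hxc (hB.subset h))]
    · rw [variation_congr hB.memLp.coeFn_toLp]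
      exact hB.perimeter_lt_top⟩ : bvSubmodule d)

/-! ### Strong charges -/

/-- The range of `T : L^d([0,1]^d) → BV([0,1]^d)^*`, `T_g(u) = ∫_{[0,1]^d} g u`. -/
def rangeT (d : ℕ) : Set (StrongDual ℝ (BV d)) :=
  {φ | ∃ g : E d → ℝ, MemLp g (d : ℝ≥0∞) (volume.restrict (unitCube d)) ∧
    ∀ u : BV d, φ u = ∫ x in unitCube d, g x * BV.toL1 u x}

/-- The space `SCH([0,1]^d)` of strong charge functionals: the closure, for the dual norm, of the
range of `T`. -/
def SCH (d : ℕ) : Set (StrongDual ℝ (BV d)) := closure (rangeT d)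

/-- Strong charges: the charges `B ↦ α(1_B)` where `α` is a strong charge functional. -/
def IsStrongCharge {d : ℕ} (μ : Set (E d) → ℝ) : Prop :=
  IsCharge μ ∧ ∃ α ∈ SCH d, ∀ (B : Set (E d)) (hB : IsBVSet B), μ B = α hB.indicator

/-! ### Increments and strong chargeability -/

/-- `f` belongs to `C_0([0,1]^d)`. Only the values of `f` on `[0,1]^d` matter. -/
def MemC0 {d : ℕ} (f : E d → ℝ) : Prop :=
  ContinuousOn f (unitCube d) ∧ ∀ x ∈ unitCube d, (∃ i, x i = 0) → f x = 0

/-- The increment `Δ_f(∏ [a i, b i])` over a rectangle: the sum over its corners `c`, with the sign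
`-1` for each coordinate at which `c i = a i`. Here `s` is the set of these coordinates. -/
def increment {d : ℕ} (f : E d → ℝ) (a b : Fin d → ℝ) : ℝ :=
  ∑ s : Finset (Fin d), (-1 : ℝ) ^ s.card *
    f (WithLp.toLp 2 (fun i => if i ∈ s then a i else b i))

/-- `box a b` is a rectangle (with non-empty interior) contained in `[0,1]^d`. -/
def IsRectangle {d : ℕ} (a b : Fin d → ℝ) : Prop := ∀ i, 0 ≤ a i ∧ a i < b i ∧ b i ≤ 1

/-- On figures, `μ` is equal to `Δ_f`. A figure is a finite union of rectangles, which may be taken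
pairwise almost disjoint, and the additive function `Δ_f` takes on it the sum of the increments
of `f` over these rectangles. -/
def ExtendsIncrement {d : ℕ} (f : E d → ℝ) (μ : Set (E d) → ℝ) : Prop :=
  ∀ (m : ℕ) (a b : Fin m → Fin d → ℝ), (∀ j, IsRectangle (a j) (b j)) →
    (∀ j k, j ≠ k → volume (box (a j) (b j) ∩ box (a k) (b k)) = 0) →
    μ (⋃ j, box (a j) (b j)) = ∑ j, increment f (a j) (b j)

/-- `f` is strongly chargeable, and `μ` is the strong charge that extends `Δ_f`. -/
def IsStrongChargeOf {d : ℕ} (f : E d → ℝ) (μ : Set (E d) → ℝ) : Prop :=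
  IsStrongCharge μ ∧ ExtendsIncrement f μ

/-- Lower corner of the dyadic cube `∏ [2^{-n} k i, 2^{-n} (k i + 1)]`. -/
def dyadicLower {d : ℕ} (n : ℕ) (k : Fin d → Fin (2 ^ n)) : Fin d → ℝ :=
  fun i => ((k i : ℕ) : ℝ) / 2 ^ n

/-- Upper corner of the dyadic cube `∏ [2^{-n} k i, 2^{-n} (k i + 1)]`. -/
def dyadicUpper {d : ℕ} (n : ℕ) (k : Fin d → Fin (2 ^ n)) : Fin d → ℝ :=
  fun i => (((k i : ℕ) : ℝ) + 1) / 2 ^ n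

/-- The dyadic cube `∏ [2^{-n} k i, 2^{-n} (k i + 1)]`, where `0 ≤ k i ≤ 2^n - 1`. -/
def dyadicCube {d : ℕ} (n : ℕ) (k : Fin d → Fin (2 ^ n)) : Set (E d) :=
  box (dyadicLower n k) (dyadicUpper n k)

/-- `μ` is `γ`-Hölder: `|μ(K)| ≤ C |K|^γ` for all dyadic cubes `K`. -/
def IsHolder {d : ℕ} (γ : ℝ) (μ : Set (E d) → ℝ) : Prop :=
  ∃ C : ℝ, 0 ≤ C ∧ ∀ (n : ℕ) (k : Fin d → Fin (2 ^ n)),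
    |μ (dyadicCube n k)| ≤ C * (volume.real (dyadicCube n k)) ^ γ

/-- `f` is `γ`-Hölder strongly chargeable: `Δ_f` extends to a strong charge that is `γ`-Hölder. -/
def IsHolderStronglyChargeable {d : ℕ} (γ : ℝ) (f : E d → ℝ) : Prop :=
  ∃ μ : Set (E d) → ℝ, IsStrongChargeOf f μ ∧ IsHolder γ μ

end StrongCharge

end

namespace StrongCharge

open scoped Convolution
open ContinuousLinearMap (lsmul)

/-! ### Testing functions of bounded variation against functions with a bounded primitive -/

/-! Let `g_n` be the step function equal to `Δ_f(K) / |K|` on each dyadic cube `K` of side `2^{-n}`.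
Its size is at most a constant times `q^n`, where `q = 2^{d(1-γ)}`, and `γ > (d-1)/d` says exactly
that `q < 2`. In general the `g_n` have no limit as functions, but the functionals `u ↦ ∫ g_n u`
converge in the norm of `BV([0,1]^d)^*`, and the limit `α` is the required strong charge functional.

Convergence rests on cancellation. Pass from `g_n` to `g_{n+1}` by halving the mesh in one
coordinate at a time. Since `Δ_f` is additive, each such change has zero integral over every mesh
interval in the direction `i` being refined (`integral_stepDensity_refine_sub`). It is therefore the
`i`-th derivative of a function bounded by its own size times `2^{-n}`, and integrating by parts
against `u` gives a bound by `‖Du‖` times that number (`integral_mul_le_of_primitive`,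
`abs_integral_mul_le_of_line_integrals`). Summing over the `d` coordinates, consecutive functionals
differ by at most a constant times `(q/2)^n`, a geometric series
(`exists_tendsto_pairing_stepDensity`).

The limit defines a charge because each `u ↦ ∫ g_n u` is continuous in `L¹` and the convergence is
uniform on bounded subsets of `BV` (`isCharge_chargeOf`). It extends `Δ_f`: for a dyadic point `x`
the integral of `g_n` over `[0,x]` equals `f(x)` for all large `n` (`integral_box_stepDensity`).
Continuity of `f` and of the charge extends this to all `x`, and inclusion-exclusion over the
corners passes from boxes at the origin to all rectangles (`extendsIncrement_chargeOf`). -/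

/-- The `i`-th vector of the standard basis. -/
noncomputable abbrev basisVec {d : ℕ} (i : Fin d) : E d := EuclideanSpace.single i (1 : ℝ)

theorem divergence_smul_basisVec {d : ℕ} {φ : E d → ℝ} (hφ : ContDiff ℝ 1 φ) (i : Fin d) (x : E d) :
    divergence (fun y => φ y • basisVec i) x = fderiv ℝ φ x (basisVec i) := by
  have h1 : fderiv ℝ (fun y => φ y • basisVec i) x
      = (fderiv ℝ φ x).smulRight (basisVec i) :=
    fderiv_smul_const ((hφ.differentiable one_ne_zero) x) _
  unfold divergence
  rw [h1, Finset.sum_eq_single i]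
  · simp
  · intro j _ hj
    simp [hj]
  · simp

theorem isTestField_smul_basisVec {d : ℕ} {φ : E d → ℝ} (hφ : ContDiff ℝ 1 φ)
    (hc : HasCompactSupport φ) (hb : ∀ x, |φ x| ≤ 1) (i : Fin d) :
    IsTestField (fun y => φ y • basisVec i) := by
  refine ⟨hφ.smul contDiff_const, hc.smul_right, fun x => ?_⟩
  rw [norm_smul]
  simpa using hb x

theorem integral_mul_divergence_le {d : ℕ} {u : E d → ℝ} (hu : variation u < ⊤) {v : E d → E d}
    (hv : IsTestField v) : ∫ x, u x * divergence v x ≤ (variation u).toReal := by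
  have h := le_iSup₂ (f := fun (v : E d → E d) (_ : IsTestField v) =>
    ENNReal.ofReal (∫ x, u x * divergence v x)) v hv
  exact (ENNReal.ofReal_le_iff_le_toReal hu.ne).1 h

/-- The field `M⁻¹ φ e_i` is admissible in the definition of the variation, and its divergence is a
single partial derivative. -/
theorem integral_mul_fderiv_le {d : ℕ} {u : E d → ℝ} (hu : variation u < ⊤) {φ : E d → ℝ}
    (hφ : ContDiff ℝ 1 φ) (hc : HasCompactSupport φ) {M : ℝ} (hM : 0 < M) (hb : ∀ x, |φ x| ≤ M)
    (i : Fin d) : ∫ x, u x * fderiv ℝ φ x (basisVec i) ≤ M * (variation u).toReal := by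
  have hφ' : ContDiff ℝ 1 (fun x => M⁻¹ * φ x) := contDiff_const.mul hφ
  have h := integral_mul_divergence_le hu (isTestField_smul_basisVec hφ' hc.mul_left
    (fun x => by
      rw [abs_mul, abs_of_pos (inv_pos.2 hM), inv_mul_le_iff₀ hM, mul_one]; exact hb x) i)
  have h2 : ∀ x, u x * divergence (fun y => (M⁻¹ * φ y) • basisVec i) x
      = M⁻¹ * (u x * fderiv ℝ φ x (basisVec i)) := fun x => by
    rw [divergence_smul_basisVec hφ', fderiv_const_mul ((hφ.differentiable one_ne_zero) x)]
    simp only [smul_apply, smul_eq_mul]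
    ring
  simp_rw [h2] at h
  rwa [integral_const_mul, inv_mul_le_iff₀ hM] at h

theorem integrable_mul_of_bounded {d : ℕ} {u w : E d → ℝ} (hu : Integrable u volume)
    (hw : Measurable w) {W : ℝ} (hW : ∀ x, |w x| ≤ W) : Integrable (fun x => u x * w x) volume :=
  hu.mul_bdd hw.aestronglyMeasurable (Eventually.of_forall hW)

theorem locallyIntegrable_of_bounded {d : ℕ} {w : E d → ℝ} (hw : Measurable w) {W : ℝ}
    (hW : ∀ x, |w x| ≤ W) : LocallyIntegrable w volume :=
  (locallyIntegrable_const W).mono hw.aestronglyMeasurable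
    (Eventually.of_forall fun x => by
      rw [Real.norm_eq_abs, Real.norm_eq_abs]; exact (hW x).trans (le_abs_self W))

/-- Fubini: mollification commutes with integration along a line. The primitive relation is used in
integrated form because `V` is only measurable and bounded and may fail to be differentiable. -/
theorem convolution_line_sub {d : ℕ} {ψ V w : E d → ℝ} {i : Fin d} {M W : ℝ}
    (hV : Measurable V) (hw : Measurable w) (hM : ∀ x, |V x| ≤ M) (hW : ∀ x, |w x| ≤ W)
    (hVw : ∀ (x : E d) (h : ℝ), V (x + h • basisVec i) - V x
      = ∫ t in (0 : ℝ)..h, w (x + t • basisVec i))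
    (hψ : Continuous ψ) (hψc : HasCompactSupport ψ) (x : E d) (h : ℝ) :
    (ψ ⋆[lsmul ℝ ℝ, volume] V) (x + h • basisVec i) - (ψ ⋆[lsmul ℝ ℝ, volume] V) x
      = ∫ t in (0 : ℝ)..h, (ψ ⋆[lsmul ℝ ℝ, volume] w) (x + t • basisVec i) := by
  have hψi : Integrable ψ volume := hψ.integrable_of_hasCompactSupport hψc
  simp only [convolution, ContinuousLinearMap.lsmul_apply, smul_eq_mul]
  rw [intervalIntegral_integral_swap, ← integral_sub]
  · refine integral_congr_ae (Eventually.of_forall fun y => ?_)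
    simp only
    rw [← mul_sub, intervalIntegral.integral_const_mul]
    have := hVw (x - y) h
    rw [show x + h • basisVec i - y = x - y + h • basisVec i by abel, this]
    congr 1
    refine intervalIntegral.integral_congr fun t _ => congrArg w ?_
    abel
  · exact integrable_mul_of_bounded hψi (hV.comp (measurable_const.sub measurable_id))
      (fun y => hM _)
  · exact integrable_mul_of_bounded hψi (hV.comp (measurable_const.sub measurable_id))
      (fun y => hM _)
  · have : IsFiniteMeasure (volume.restrict (Set.uIoc 0 h)) :=
      ⟨by rw [Measure.restrict_apply_univ, Set.uIoc]; exact measure_Ioc_lt_top⟩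
    have h1 : Integrable (fun p : ℝ × E d => ψ p.2)
        ((volume.restrict (Set.uIoc 0 h)).prod volume) := hψi.comp_snd _
    refine h1.mul_bdd (c := W) ?_ (Eventually.of_forall fun p => hW _)
    refine (hw.comp ?_).aestronglyMeasurable
    fun_prop

/-- The mollified `V` is `C¹` and the mollified `w` is continuous, so the integrated relation can be
differentiated at `h = 0` by the fundamental theorem of calculus. -/
theorem fderiv_convolution_basisVec {d : ℕ} {ψ V w : E d → ℝ} {i : Fin d} {M W : ℝ}
    (hV : Measurable V) (hw : Measurable w) (hM : ∀ x, |V x| ≤ M) (hW : ∀ x, |w x| ≤ W)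
    (hVw : ∀ (x : E d) (h : ℝ), V (x + h • basisVec i) - V x
      = ∫ t in (0 : ℝ)..h, w (x + t • basisVec i))
    (hψ : ContDiff ℝ 1 ψ) (hψc : HasCompactSupport ψ) (x : E d) :
    fderiv ℝ (ψ ⋆[lsmul ℝ ℝ, volume] V) x (basisVec i) = (ψ ⋆[lsmul ℝ ℝ, volume] w) x := by
  have hF : ContDiff ℝ 1 (ψ ⋆[lsmul ℝ ℝ, volume] V) :=
    hψc.contDiff_convolution_left (n := 1) _ hψ (locallyIntegrable_of_bounded hV hM)
  have hG : Continuous (ψ ⋆[lsmul ℝ ℝ, volume] w) :=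
    hψc.continuous_convolution_left _ hψ.continuous (locallyIntegrable_of_bounded hw hW)
  have h1 : HasLineDerivAt ℝ (ψ ⋆[lsmul ℝ ℝ, volume] V)
      (fderiv ℝ (ψ ⋆[lsmul ℝ ℝ, volume] V) x (basisVec i)) x (basisVec i) :=
    ((hF.differentiable one_ne_zero) x).hasFDerivAt.hasLineDerivAt _
  have h2 : HasDerivAt (fun h : ℝ => ∫ t in (0 : ℝ)..h,
      (ψ ⋆[lsmul ℝ ℝ, volume] w) (x + t • basisVec i))
      ((ψ ⋆[lsmul ℝ ℝ, volume] w) (x + (0 : ℝ) • basisVec i)) 0 := by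
    have hc : Continuous fun t : ℝ => (ψ ⋆[lsmul ℝ ℝ, volume] w) (x + t • basisVec i) := by
      fun_prop
    exact hc.integral_hasStrictDerivAt 0 0 |>.hasDerivAt
  have h3 : HasDerivAt (fun h : ℝ => (ψ ⋆[lsmul ℝ ℝ, volume] V) (x + h • basisVec i))
      ((ψ ⋆[lsmul ℝ ℝ, volume] w) (x + (0 : ℝ) • basisVec i)) 0 := by
    have := h2.add_const ((ψ ⋆[lsmul ℝ ℝ, volume] V) x)
    refine this.congr_of_eventuallyEq (Eventually.of_forall fun h => ?_)
    simp only
    rw [← convolution_line_sub hV hw hM hW hVw hψ.continuous hψc x h]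
    ring
  have := HasDerivAt.unique h1 h3
  simpa using this

theorem abs_convolution_normed_le {d : ℕ} (φ : ContDiffBump (0 : E d)) {V : E d → ℝ} {M : ℝ}
    (hM : ∀ x, |V x| ≤ M) (x : E d) :
    |(φ.normed volume ⋆[lsmul ℝ ℝ, volume] V) x| ≤ M := by
  have h1 : Integrable (fun y => φ.normed volume y * M) volume := φ.integrable_normed.mul_const M
  have := norm_integral_le_of_norm_le (f := fun y => φ.normed volume y * V (x - y)) h1
    (Eventually.of_forall fun y => by
      rw [norm_mul, Real.norm_of_nonneg (φ.nonneg_normed y)]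
      exact mul_le_mul_of_nonneg_left (hM _) (φ.nonneg_normed y))
  rw [integral_mul_const, φ.integral_normed, one_mul] at this
  simpa only [convolution, ContinuousLinearMap.lsmul_apply, smul_eq_mul, Real.norm_eq_abs] using this

/-- If `V` is a primitive of `w` in the `i`-th coordinate, then the integral of `u w` is controlled
by the supremum of `V` and the variation of `u`. -/
theorem integral_mul_le_of_primitive {d : ℕ} {u V w : E d → ℝ} {i : Fin d} {M W : ℝ}
    (hu : Integrable u volume) (huv : variation u < ⊤)
    (hV : Measurable V) (hw : Measurable w) (hM0 : 0 < M)
    (hM : ∀ x, |V x| ≤ M) (hW : ∀ x, |w x| ≤ W) (hVc : HasCompactSupport V)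
    (hVw : ∀ (x : E d) (h : ℝ), V (x + h • basisVec i) - V x
      = ∫ t in (0 : ℝ)..h, w (x + t • basisVec i)) :
    ∫ x, u x * w x ≤ M * (variation u).toReal := by
  -- The outer radius is twice the inner one: almost everywhere convergence of the mollifications of
  -- a merely measurable `w` requires a bounded ratio of radii, here `K = 2`.
  let φ : ℕ → ContDiffBump (0 : E d) := fun n =>
    ⟨1 / ((n : ℝ) + 1), 2 * (1 / ((n : ℝ) + 1)), by positivity, by
      have : 0 < 1 / ((n : ℝ) + 1) := by positivity
      linarith⟩
  have hφ : Tendsto (fun n => (φ n).rOut) atTop (𝓝 0) := by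
    have := (tendsto_one_div_add_atTop_nhds_zero_nat (𝕜 := ℝ)).const_mul 2
    rwa [mul_zero] at this
  have hae := ContDiffBump.ae_convolution_tendsto_right_of_locallyIntegrable (μ := volume)
    (K := 2) hφ (Eventually.of_forall fun n => le_rfl) (locallyIntegrable_of_bounded hw hW)
  have hlim : Tendsto (fun n => ∫ x, u x * ((φ n).normed volume ⋆[lsmul ℝ ℝ, volume] w) x) atTop
      (𝓝 (∫ x, u x * w x)) := by
    refine tendsto_integral_of_dominated_convergence (fun x => |u x| * W) (fun n => ?_)
      (hu.abs.mul_const W) (fun n => Eventually.of_forall fun x => ?_) ?_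
    · exact hu.aestronglyMeasurable.mul
        ((φ n).hasCompactSupport_normed.continuous_convolution_left _ (φ n).continuous_normed
          (locallyIntegrable_of_bounded hw hW)).aestronglyMeasurable
    · rw [norm_mul, Real.norm_eq_abs, Real.norm_eq_abs]
      exact mul_le_mul_of_nonneg_left (abs_convolution_normed_le _ hW x) (abs_nonneg _)
    · filter_upwards [hae] with x hx
      exact hx.const_mul (u x)
  refine le_of_tendsto' hlim fun n => ?_
  have h1 : ∀ x, u x * ((φ n).normed volume ⋆[lsmul ℝ ℝ, volume] w) x
      = u x * fderiv ℝ ((φ n).normed volume ⋆[lsmul ℝ ℝ, volume] V) x (basisVec i) := fun x => by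
    rw [fderiv_convolution_basisVec hV hw hM hW hVw (φ n).contDiff_normed
      (φ n).hasCompactSupport_normed]
  simp_rw [h1]
  refine integral_mul_fderiv_le huv ?_ ?_ hM0 (abs_convolution_normed_le _ hM) i
  · exact (φ n).hasCompactSupport_normed.contDiff_convolution_left (n := 1) _
      (φ n).contDiff_normed (locallyIntegrable_of_bounded hV hM)
  · exact (φ n).hasCompactSupport_normed.convolution _ hVc

/-! ### Functions with vanishing integrals along the edges of a grid -/

/-- The point `x` with its `i`-th coordinate replaced by `t`. -/
def replaceCoord {d : ℕ} (x : E d) (i : Fin d) (t : ℝ) : E d :=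
  WithLp.toLp 2 (Function.update x.ofLp i t)

@[simp]
theorem replaceCoord_same {d : ℕ} (x : E d) (i : Fin d) (t : ℝ) : replaceCoord x i t i = t := by
  simp [replaceCoord]

theorem replaceCoord_of_ne {d : ℕ} (x : E d) {i j : Fin d} (h : j ≠ i) (t : ℝ) :
    replaceCoord x i t j = x j := by
  simp [replaceCoord, h]

theorem replaceCoord_self {d : ℕ} (x : E d) (i : Fin d) : replaceCoord x i (x i) = x := by
  ext j
  by_cases h : j = i
  · subst h; simp
  · rw [replaceCoord_of_ne x h]

theorem replaceCoord_add_smul {d : ℕ} (x : E d) (i : Fin d) (h t : ℝ) :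
    replaceCoord (x + h • basisVec i) i t = replaceCoord x i t := by
  ext j
  by_cases hj : j = i
  · subst hj; simp
  · rw [replaceCoord_of_ne _ hj, replaceCoord_of_ne _ hj]
    simp [hj]

theorem replaceCoord_apply_add {d : ℕ} (x : E d) (i : Fin d) (t : ℝ) :
    replaceCoord x i (x i + t) = x + t • basisVec i := by
  ext j
  by_cases hj : j = i
  · subst hj; simp
  · rw [replaceCoord_of_ne _ hj]
    simp [hj]

theorem continuous_replaceCoord {d : ℕ} (i : Fin d) :
    Continuous fun p : E d × ℝ => replaceCoord p.1 i p.2 := by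
  unfold replaceCoord
  refine (PiLp.continuous_toLp 2 _).comp (Continuous.update ?_ i continuous_snd)
  fun_prop

theorem measurable_line {d : ℕ} {w : E d → ℝ} (hw : Measurable w) (x : E d) (i : Fin d) :
    Measurable fun t => w (replaceCoord x i t) :=
  hw.comp ((continuous_replaceCoord i).comp (Continuous.prodMk_right x)).measurable

theorem intervalIntegrable_line {d : ℕ} {w : E d → ℝ} (hw : Measurable w) {W : ℝ}
    (hW : ∀ x, |w x| ≤ W) (x : E d) (i : Fin d) (a b : ℝ) :
    IntervalIntegrable (fun t => w (replaceCoord x i t)) volume a b :=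
  (intervalIntegrable_const (c := W)).mono_fun (measurable_line hw x i).aestronglyMeasurable
    (Eventually.of_forall fun t => by
      simpa only [Real.norm_eq_abs] using (hW _).trans (le_abs_self W))

/-- The half-open unit cube. -/
def halfOpenCube (d : ℕ) : Set (E d) := {x | ∀ i, 0 ≤ x i ∧ x i < 1}

theorem halfOpenCube_subset (d : ℕ) : halfOpenCube d ⊆ unitCube d :=
  fun _ hx i => ⟨(hx i).1, (hx i).2.le⟩

theorem measurableSet_halfOpenCube (d : ℕ) : MeasurableSet (halfOpenCube d) := by
  unfold halfOpenCube
  simp only [Set.ofPred_forall]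
  refine MeasurableSet.iInter fun i => ?_
  have hm : Measurable fun x : E d => x i := by fun_prop
  exact (measurableSet_le measurable_const hm).inter (measurableSet_lt hm measurable_const)

theorem isCompact_box {d : ℕ} (a b : Fin d → ℝ) : IsCompact (box a b) := by
  have h : box a b = WithLp.toLp 2 '' (Set.univ.pi fun i => Set.Icc (a i) (b i)) := by
    ext x
    constructor
    · intro hx
      exact ⟨x.ofLp, fun i _ => hx i, rfl⟩
    · rintro ⟨y, hy, rfl⟩ i
      exact hy i trivial
  rw [h]
  exact (isCompact_univ_pi fun i => isCompact_Icc).image (PiLp.continuous_toLp 2 _)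

/-- The primitive of `w` in direction `i` starting at `0` vanishes at every nonnegative grid
coordinate, so it never exceeds `W` times one mesh length. It also vanishes outside the unit cube,
hence is an admissible compactly supported primitive. -/
theorem abs_integral_mul_le_of_line_integrals {d : ℕ} {u w : E d → ℝ} {i : Fin d} {W : ℝ} {n : ℕ}
    (hu : Integrable u volume) (huv : variation u < ⊤) (hw : Measurable w) (hW0 : 0 < W)
    (hW : ∀ x, |w x| ≤ W) (hwQ : ∀ x ∉ halfOpenCube d, w x = 0)
    (hcell : ∀ (x : E d) (k : ℕ),
      ∫ t in (k : ℝ) / 2 ^ n..((k : ℝ) + 1) / 2 ^ n, w (replaceCoord x i t) = 0) :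
    |∫ x, u x * w x| ≤ W / 2 ^ n * (variation u).toReal := by
  have h2 : (0 : ℝ) < 2 ^ n := by positivity
  have hint := fun x a b => intervalIntegrable_line hw hW x i a b
  have hgrid : ∀ (x : E d) (k : ℕ), ∫ t in (0 : ℝ)..(k : ℝ) / 2 ^ n, w (replaceCoord x i t) = 0 := by
    intro x k
    induction k with
    | zero => simp
    | succ k ih =>
      rw [← intervalIntegral.integral_add_adjacent_intervals (hint x _ _) (hint x _ _), ih]
      push_cast
      rw [hcell, add_zero]
  have hneg : ∀ (x : E d) (s : ℝ), s ≤ 0 → ∫ t in (0 : ℝ)..s, w (replaceCoord x i t) = 0 := by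
    intro x s hs
    rw [intervalIntegral.integral_symm, intervalIntegral.integral_of_le hs,
      ← integral_Ico_eq_integral_Ioc, setIntegral_eq_zero_of_forall_eq_zero, neg_zero]
    intro t ht
    refine hwQ _ fun hq => ?_
    have := (hq i).1
    rw [replaceCoord_same] at this
    exact absurd ht.2 (not_lt.2 this)
  set V : E d → ℝ := fun x => ∫ t in (0 : ℝ)..x i, w (replaceCoord x i t) with hVdef
  have hM : ∀ x, |V x| ≤ W / 2 ^ n := by
    intro x
    rcases le_total (x i) 0 with h0 | h0
    · rw [hVdef]; simp only
      rw [hneg x _ h0, abs_zero]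
      positivity
    · have hk1 : ((⌊2 ^ n * x i⌋₊ : ℕ) : ℝ) / 2 ^ n ≤ x i := by
        rw [div_le_iff₀ h2, mul_comm]
        exact Nat.floor_le (by positivity)
      have hk2 : x i ≤ ((⌊2 ^ n * x i⌋₊ : ℕ) : ℝ) / 2 ^ n + 1 / 2 ^ n := by
        rw [← add_div, le_div_iff₀ h2, mul_comm]
        exact (Nat.lt_floor_add_one _).le
      have h1 : V x = ∫ t in ((⌊2 ^ n * x i⌋₊ : ℕ) : ℝ) / 2 ^ n..x i, w (replaceCoord x i t) := by
        rw [hVdef]; simp only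
        rw [← intervalIntegral.integral_add_adjacent_intervals (hint x 0 _) (hint x _ _),
          hgrid, zero_add]
      have h3 := intervalIntegral.norm_integral_le_of_norm_le_const
        (a := ((⌊2 ^ n * x i⌋₊ : ℕ) : ℝ) / 2 ^ n) (b := x i)
        (f := fun t => w (replaceCoord x i t)) (C := W) (fun t _ => hW _)
      rw [← h1, Real.norm_eq_abs, abs_of_nonneg (sub_nonneg.2 hk1)] at h3
      refine h3.trans ?_
      rw [div_eq_mul_one_div W]
      exact mul_le_mul_of_nonneg_left (by linarith) hW0.le
  have hVQ : ∀ x ∉ unitCube d, V x = 0 := by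
    intro x hx
    -- Either the whole line through `x` misses the cube, or `x` lies on a line through it but
    -- before `0` or beyond `1`. In the last case the integral over `[0,1]` is a sum of `2^n`
    -- vanishing cell integrals.
    by_cases hj : ∃ j, j ≠ i ∧ ¬ (0 ≤ x j ∧ x j ≤ 1)
    · obtain ⟨j, hji, hj⟩ := hj
      have : ∀ t, w (replaceCoord x i t) = 0 := fun t => hwQ _ fun hq => hj (by
        have := hq j
        rw [replaceCoord_of_ne _ hji] at this
        exact ⟨this.1, this.2.le⟩)
      simp [hVdef, this]
    · push Not at hj
      rcases le_total (x i) 0 with h0 | h0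
      · exact hneg x _ h0
      · have h1 : 1 ≤ x i := by
          by_contra! hlt
          refine hx fun j => ?_
          by_cases hji : j = i
          · subst hji; exact ⟨h0, hlt.le⟩
          · exact hj j hji
        have hg := hgrid x (2 ^ n)
        push_cast at hg
        rw [div_self h2.ne'] at hg
        rw [hVdef]; simp only
        rw [← intervalIntegral.integral_add_adjacent_intervals (hint x 0 1) (hint x 1 _), hg,
          zero_add, intervalIntegral.integral_of_le h1, setIntegral_eq_zero_of_forall_eq_zero]
        intro t ht
        refine hwQ _ fun hq => ?_
        have := (hq i).2
        rw [replaceCoord_same] at this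
        exact absurd ht.1 (not_lt.2 this.le)
  have hVc : HasCompactSupport V :=
    HasCompactSupport.intro (isCompact_box _ _) hVQ
  have hVm : Measurable V := by
    -- Substituting `t = s * x i` makes the interval of integration independent of `x`, so that
    -- measurability of integrals with a parameter applies.
    have h1 : V = fun x => x i * ∫ s in Set.Ioc (0 : ℝ) 1, w (replaceCoord x i (s * x i)) := by
      funext x
      have := intervalIntegral.mul_integral_comp_mul_right (a := 0) (b := 1)
        (f := fun t => w (replaceCoord x i t)) (x i)
      rw [zero_mul, one_mul] at this
      rw [hVdef]; simp only
      rw [← this, intervalIntegral.integral_of_le zero_le_one]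
    rw [h1]
    refine Measurable.mul (by fun_prop) ?_
    have h3 : Measurable (fun p : E d × ℝ => w (replaceCoord p.1 i (p.2 * p.1 i))) := by
      have hc : Continuous fun p : E d × ℝ => (p.1, p.2 * p.1 i) := by fun_prop
      exact hw.comp ((continuous_replaceCoord i).comp hc).measurable
    exact (h3.stronglyMeasurable.integral_prod_right'
      (ν := volume.restrict (Set.Ioc (0 : ℝ) 1))).measurable
  have hVw : ∀ (x : E d) (h : ℝ), V (x + h • basisVec i) - V x
      = ∫ t in (0 : ℝ)..h, w (x + t • basisVec i) := by
    intro x h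
    rw [hVdef]; simp only [replaceCoord_add_smul]
    have h1 : (x + h • basisVec i) i = x i + h := by simp
    rw [h1, intervalIntegral.integral_interval_sub_left (hint x _ _) (hint x _ _)]
    have h3 := intervalIntegral.integral_comp_add_left (a := 0) (b := h)
      (fun t => w (replaceCoord x i t)) (x i)
    rw [add_zero] at h3
    rw [← h3]
    simp_rw [replaceCoord_apply_add]
  have hWn : 0 < W / 2 ^ n := by positivity
  refine abs_le.2 ⟨?_, integral_mul_le_of_primitive hu huv hVm hw hWn hM hW hVc hVw⟩
  -- The one-sided bound applied to `-V` and `-w` gives the lower estimate.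
  have h := integral_mul_le_of_primitive (V := fun x => -V x) (w := fun x => -w x) (i := i) (W := W)
    hu huv hVm.neg hw.neg hWn (fun x => by rw [abs_neg]; exact hM x)
    (fun x => by rw [abs_neg]; exact hW x) hVc.neg
    (fun x h => by rw [intervalIntegral.integral_neg, ← hVw]; ring)
  simp only [mul_neg, integral_neg] at h
  linarith

/-! ### Step functions with prescribed increments -/

/-- Pair each corner set `s` not containing `i` with `insert i s`. The corners whose `i`-th
coordinate is `c` occur in both increments with opposite signs and cancel; the order of `a i`, `c`,
`b i` plays no role. -/
theorem increment_split {d : ℕ} (f : E d → ℝ) (a b : Fin d → ℝ) (i : Fin d) (c : ℝ) :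
    increment f a b = increment f a (Function.update b i c) + increment f (Function.update a i c) b := by
  classical
  have key : ∀ g : Finset (Fin d) → ℝ, ∑ s : Finset (Fin d), g s
      = ∑ s ∈ (Finset.univ.erase i).powerset, (g s + g (insert i s)) := by
    intro g
    rw [← Finset.powerset_univ, ← Finset.insert_erase (Finset.mem_univ i),
      Finset.sum_powerset_insert (Finset.notMem_erase i _), Finset.erase_insert
      (Finset.notMem_erase i _), ← Finset.sum_add_distrib]
  unfold increment
  rw [key, key, key, ← Finset.sum_add_distrib]
  refine Finset.sum_congr rfl fun s hs => ?_
  have his : i ∉ s := fun h => Finset.notMem_erase i _ (Finset.mem_powerset.1 hs h)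
  rw [Finset.card_insert_of_notMem his, pow_succ]
  have h1 : (fun j => if j ∈ s then Function.update a i c j else b j)
      = fun j => if j ∈ s then a j else b j := by
    funext j
    split_ifs with h
    · rw [Function.update_of_ne (by rintro rfl; exact his h)]
    · rfl
  have h2 : (fun j => if j ∈ insert i s then a j else Function.update b i c j)
      = fun j => if j ∈ insert i s then a j else b j := by
    funext j
    split_ifs with h
    · rfl
    · rw [Function.update_of_ne (by rintro rfl; exact h (Finset.mem_insert_self _ s))]
  have h3 : (fun j => if j ∈ insert i s then Function.update a i c j else b j)
      = fun j => if j ∈ s then a j else Function.update b i c j := by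
    funext j
    by_cases hj : j = i
    · subst hj; simp [his]
    · simp [hj]
  rw [h1, h2, h3]
  ring

/-- Lower corner of the cell of the grid with mesh `2^{-N i}` that contains `y`. -/
noncomputable def gridLower {d : ℕ} (N : Fin d → ℕ) (y : E d) : Fin d → ℝ :=
  fun i => (⌊2 ^ N i * y i⌋ : ℝ) / 2 ^ N i

/-- Upper corner of the cell of the grid with mesh `2^{-N i}` that contains `y`. -/
noncomputable def gridUpper {d : ℕ} (N : Fin d → ℕ) (y : E d) : Fin d → ℝ :=
  fun i => ((⌊2 ^ N i * y i⌋ : ℝ) + 1) / 2 ^ N i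

/-- The step function on the unit cube that is constant on the cells of the grid with mesh
`2^{-N i}` and whose integral over a cell is the increment of `f`. -/
noncomputable def stepDensity {d : ℕ} (f : E d → ℝ) (N : Fin d → ℕ) : E d → ℝ :=
  (halfOpenCube d).indicator fun y =>
    (∏ i, (2 : ℝ) ^ N i) * increment f (gridLower N y) (gridUpper N y)

/-- Such a function factors through the countable set `ℤ^d`, so nothing is asked of `F`. -/
theorem measurable_floor_comp {d : ℕ} (N : Fin d → ℕ) (F : (Fin d → ℤ) → ℝ) :
    Measurable fun y : E d => F fun i => ⌊2 ^ N i * y i⌋ := by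
  refine (measurable_of_countable F).comp (measurable_pi_lambda _ fun i => ?_)
  refine Int.measurable_floor.comp ?_
  fun_prop

theorem measurable_stepDensity {d : ℕ} (f : E d → ℝ) (N : Fin d → ℕ) :
    Measurable (stepDensity f N) := by
  refine Measurable.indicator ?_ (measurableSet_halfOpenCube d)
  exact (measurable_floor_comp N fun k => increment f (fun i => (k i : ℝ) / 2 ^ N i)
    (fun i => ((k i : ℝ) + 1) / 2 ^ N i)).const_mul _

theorem stepDensity_of_notMem {d : ℕ} (f : E d → ℝ) (N : Fin d → ℕ) {y : E d}
    (hy : y ∉ halfOpenCube d) : stepDensity f N y = 0 :=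
  Set.indicator_of_notMem hy _

theorem floor_two_pow_mul {n : ℕ} {k : ℤ} {t : ℝ} (h1 : (k : ℝ) / 2 ^ n ≤ t)
    (h2 : t < ((k : ℝ) + 1) / 2 ^ n) : ⌊2 ^ n * t⌋ = k := by
  have h : (0 : ℝ) < 2 ^ n := by positivity
  rw [Int.floor_eq_iff]
  rw [div_le_iff₀ h] at h1
  rw [lt_div_iff₀ h] at h2
  constructor <;> linarith

/-- Refining the grid in the `i`-th direction splits the value of the step function along a line
in that direction into an average. -/
theorem exists_stepDensity_refine {d : ℕ} (f : E d → ℝ) (N : Fin d → ℕ) (i : Fin d) (x : E d)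
    (k : ℕ) : ∃ c₁ c₂ : ℝ,
    (∀ t ∈ Set.Ico ((k : ℝ) / 2 ^ N i) ((k + 1 / 2 : ℝ) / 2 ^ N i),
      stepDensity f (Function.update N i (N i + 1)) (replaceCoord x i t) = c₁) ∧
    (∀ t ∈ Set.Ico ((k + 1 / 2 : ℝ) / 2 ^ N i) ((k + 1 : ℝ) / 2 ^ N i),
      stepDensity f (Function.update N i (N i + 1)) (replaceCoord x i t) = c₂) ∧
    (∀ t ∈ Set.Ico ((k : ℝ) / 2 ^ N i) ((k + 1 : ℝ) / 2 ^ N i),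
      stepDensity f N (replaceCoord x i t) = (c₁ + c₂) / 2) := by
  classical
  have h2 : (0 : ℝ) < 2 ^ N i := by positivity
  have hlt1 : (k : ℝ) / 2 ^ N i < (k + 1 / 2 : ℝ) / 2 ^ N i := by gcongr; linarith
  have hlt2 : (k + 1 / 2 : ℝ) / 2 ^ N i < (k + 1 : ℝ) / 2 ^ N i := by gcongr; linarith
  -- Otherwise this segment of the line misses the half-open cube, and all three values are `0`.
  by_cases hA : k < 2 ^ N i ∧ ∀ j, j ≠ i → 0 ≤ x j ∧ x j < 1
  · have hmem : ∀ t ∈ Set.Ico ((k : ℝ) / 2 ^ N i) ((k + 1 : ℝ) / 2 ^ N i),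
        replaceCoord x i t ∈ halfOpenCube d := by
      intro t ht j
      by_cases hj : j = i
      · subst hj
        rw [replaceCoord_same]
        refine ⟨le_trans (by positivity) ht.1, ht.2.trans_le ?_⟩
        rw [div_le_one h2]
        exact_mod_cast hA.1
      · rw [replaceCoord_of_ne _ hj]
        exact hA.2 j hj
    set a : Fin d → ℝ := gridLower N (replaceCoord x i ((k : ℝ) / 2 ^ N i)) with ha
    set b : Fin d → ℝ := gridUpper N (replaceCoord x i ((k : ℝ) / 2 ^ N i)) with hb
    set m : ℝ := (k + 1 / 2 : ℝ) / 2 ^ N i with hm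
    have hfl : ∀ t ∈ Set.Ico ((k : ℝ) / 2 ^ N i) ((k + 1 : ℝ) / 2 ^ N i),
        ⌊2 ^ N i * t⌋ = (k : ℤ) := fun t ht =>
      floor_two_pow_mul (by rw [Int.cast_natCast]; exact ht.1) (by rw [Int.cast_natCast]; exact ht.2)
    have hfl1 : ∀ t ∈ Set.Ico ((k : ℝ) / 2 ^ N i) m, ⌊2 ^ (N i + 1) * t⌋ = 2 * (k : ℤ) := by
      intro t ht
      refine floor_two_pow_mul ?_ ?_
      · refine le_trans (le_of_eq ?_) ht.1
        push_cast; field_simp; ring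
      · refine ht.2.trans_le (le_of_eq ?_)
        rw [hm]; push_cast; field_simp; ring
    have hfl2 : ∀ t ∈ Set.Ico m ((k + 1 : ℝ) / 2 ^ N i),
        ⌊2 ^ (N i + 1) * t⌋ = 2 * (k : ℤ) + 1 := by
      intro t ht
      refine floor_two_pow_mul ?_ ?_
      · refine le_trans (le_of_eq ?_) ht.1
        rw [hm]; push_cast; field_simp; ring
      · refine ht.2.trans_le (le_of_eq ?_)
        push_cast; field_simp; ring
    have hprod : ∏ j, (2 : ℝ) ^ (Function.update N i (N i + 1) j) = 2 * ∏ j, (2 : ℝ) ^ N j := by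
      rw [← Finset.mul_prod_erase _ _ (Finset.mem_univ i),
        ← Finset.mul_prod_erase _ (fun j => (2 : ℝ) ^ N j) (Finset.mem_univ i),
        Function.update_self, pow_succ]
      rw [Finset.prod_congr rfl fun j hj => by
        rw [Function.update_of_ne (Finset.ne_of_mem_erase hj)]]
      ring
    have hk0 : ((k : ℝ) / 2 ^ N i) ∈ Set.Ico ((k : ℝ) / 2 ^ N i) ((k + 1 : ℝ) / 2 ^ N i) :=
      ⟨le_rfl, hlt1.trans hlt2⟩
    have hai : a i = (k : ℝ) / 2 ^ N i := by
      simp only [ha, gridLower, replaceCoord_same, hfl _ hk0, Int.cast_natCast]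
    have hbi : b i = (k + 1 : ℝ) / 2 ^ N i := by
      simp only [hb, gridUpper, replaceCoord_same, hfl _ hk0, Int.cast_natCast]
    have haj : ∀ j ≠ i, a j = (⌊2 ^ N j * x j⌋ : ℝ) / 2 ^ N j := fun j hj => by
      simp only [ha, gridLower, replaceCoord_of_ne x hj]
    have hbj : ∀ j ≠ i, b j = ((⌊2 ^ N j * x j⌋ : ℝ) + 1) / 2 ^ N j := fun j hj => by
      simp only [hb, gridUpper, replaceCoord_of_ne x hj]
    -- A half cell has half the volume, hence the factor `2`. The averaging identity is then
    -- additivity of the increment across the midpoint `m`.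
    refine ⟨2 * (∏ j, (2 : ℝ) ^ N j) * increment f a (Function.update b i m),
      2 * (∏ j, (2 : ℝ) ^ N j) * increment f (Function.update a i m) b, ?_, ?_, ?_⟩
    · intro t ht
      rw [stepDensity, Set.indicator_of_mem (hmem t ⟨ht.1, ht.2.trans hlt2⟩), hprod]
      congr 2
      · funext j
        by_cases hj : j = i
        · subst hj
          simp only [gridLower, Function.update_self, replaceCoord_same, hfl1 t ht, hai]
          push_cast; field_simp; ring
        · simp only [gridLower, Function.update_of_ne hj, replaceCoord_of_ne x hj, haj j hj]
      · funext j
        by_cases hj : j = i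
        · subst hj
          simp only [gridUpper, Function.update_self, replaceCoord_same, hfl1 t ht, hm]
          push_cast; field_simp; ring
        · simp only [gridUpper, Function.update_of_ne hj, replaceCoord_of_ne x hj, hbj j hj]
    · intro t ht
      rw [stepDensity, Set.indicator_of_mem (hmem t ⟨hlt1.le.trans ht.1, ht.2⟩), hprod]
      congr 2
      · funext j
        by_cases hj : j = i
        · subst hj
          simp only [gridLower, Function.update_self, replaceCoord_same, hfl2 t ht, hm]
          push_cast; field_simp; ring
        · simp only [gridLower, Function.update_of_ne hj, replaceCoord_of_ne x hj, haj j hj]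
      · funext j
        by_cases hj : j = i
        · subst hj
          simp only [gridUpper, Function.update_self, replaceCoord_same, hfl2 t ht, hbi]
          push_cast; field_simp; ring
        · simp only [gridUpper, Function.update_of_ne hj, replaceCoord_of_ne x hj, hbj j hj]
    · intro t ht
      rw [stepDensity, Set.indicator_of_mem (hmem t ht)]
      have e1 : gridLower N (replaceCoord x i t) = a := by
        funext j
        by_cases hj : j = i
        · subst hj
          simp only [gridLower, replaceCoord_same, hfl t ht, hai, Int.cast_natCast]
        · simp only [gridLower, replaceCoord_of_ne x hj, haj j hj]
      have e2 : gridUpper N (replaceCoord x i t) = b := by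
        funext j
        by_cases hj : j = i
        · subst hj
          simp only [gridUpper, replaceCoord_same, hfl t ht, hbi, Int.cast_natCast]
        · simp only [gridUpper, replaceCoord_of_ne x hj, hbj j hj]
      rw [e1, e2, increment_split f a b i m]
      ring
  · have hnot : ∀ t ∈ Set.Ico ((k : ℝ) / 2 ^ N i) ((k + 1 : ℝ) / 2 ^ N i),
        replaceCoord x i t ∉ halfOpenCube d := by
      intro t ht hq
      refine hA ⟨?_, fun j hj => ?_⟩
      · have h1 := (hq i).2
        rw [replaceCoord_same] at h1
        have := ht.1.trans_lt h1
        rw [div_lt_one h2] at this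
        exact_mod_cast this
      · have := hq j
        rwa [replaceCoord_of_ne _ hj] at this
    refine ⟨0, 0, fun t ht => ?_, fun t ht => ?_, fun t ht => ?_⟩
    · exact stepDensity_of_notMem _ _ (hnot t ⟨ht.1, ht.2.trans hlt2⟩)
    · exact stepDensity_of_notMem _ _ (hnot t ⟨hlt1.le.trans ht.1, ht.2⟩)
    · rw [stepDensity_of_notMem _ _ (hnot t ht)]
      norm_num

/-- An average of two values is no larger than the larger of them, so a bound on a fine grid is
inherited by every coarser one. This bounds the grids with different meshes in different directions,
whose cells are not cubes and which the hypothesis on `f` does not cover. -/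
theorem abs_stepDensity_le_of_refine {d : ℕ} {f : E d → ℝ} {N : Fin d → ℕ} {i : Fin d} {S : ℝ}
    (hS0 : 0 ≤ S) (hS : ∀ x, |stepDensity f (Function.update N i (N i + 1)) x| ≤ S) (x : E d) :
    |stepDensity f N x| ≤ S := by
  have h2 : (0 : ℝ) < 2 ^ N i := by positivity
  by_cases hx : x ∈ halfOpenCube d
  · obtain ⟨c₁, c₂, h₁, h₂, h⟩ := exists_stepDensity_refine f N i x ⌊2 ^ N i * x i⌋₊
    set k := ⌊2 ^ N i * x i⌋₊
    have hlt1 : (k : ℝ) / 2 ^ N i < (k + 1 / 2 : ℝ) / 2 ^ N i := by gcongr; linarith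
    have hlt2 : (k + 1 / 2 : ℝ) / 2 ^ N i < (k + 1 : ℝ) / 2 ^ N i := by gcongr; linarith
    have e1 := hS (replaceCoord x i ((k : ℝ) / 2 ^ N i))
    have e2 := hS (replaceCoord x i ((k + 1 / 2 : ℝ) / 2 ^ N i))
    rw [h₁ _ ⟨le_rfl, hlt1⟩] at e1
    rw [h₂ _ ⟨le_rfl, hlt2⟩] at e2
    have e3 := h (x i) ⟨?_, ?_⟩
    · rw [replaceCoord_self] at e3
      rw [e3, abs_le]
      rw [abs_le] at e1 e2
      constructor <;> linarith
    · rw [div_le_iff₀ h2, mul_comm]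
      exact Nat.floor_le (mul_nonneg h2.le (hx i).1)
    · rw [lt_div_iff₀ h2, mul_comm]
      exact Nat.lt_floor_add_one _
  · rw [stepDensity_of_notMem _ _ hx, abs_zero]
    exact hS0

theorem intervalIntegral_eq_of_eqOn_Ico {g : ℝ → ℝ} {a b c : ℝ} (hab : a ≤ b)
    (h : ∀ t ∈ Set.Ico a b, g t = c) : ∫ t in a..b, g t = c * (b - a) := by
  rw [intervalIntegral.integral_of_le hab, ← integral_Ico_eq_integral_Ioc,
    setIntegral_congr_fun measurableSet_Ico h, setIntegral_const, smul_eq_mul, mul_comm,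
    Real.volume_real_Ico_of_le hab]

theorem integral_stepDensity_refine_sub {d : ℕ} {f : E d → ℝ} {N : Fin d → ℕ} {i : Fin d} {S : ℝ}
    (hS0 : 0 ≤ S) (hS : ∀ x, |stepDensity f (Function.update N i (N i + 1)) x| ≤ S) (x : E d)
    (k : ℕ) :
    ∫ t in (k : ℝ) / 2 ^ N i..((k : ℝ) + 1) / 2 ^ N i,
      (stepDensity f (Function.update N i (N i + 1)) (replaceCoord x i t)
        - stepDensity f N (replaceCoord x i t)) = 0 := by
  have hint := fun a b => intervalIntegrable_line (measurable_stepDensity f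
    (Function.update N i (N i + 1))) hS x i a b
  have hint' := fun a b => intervalIntegrable_line (measurable_stepDensity f N)
    (abs_stepDensity_le_of_refine hS0 hS) x i a b
  obtain ⟨c₁, c₂, h₁, h₂, h⟩ := exists_stepDensity_refine f N i x k
  have hlt1 : (k : ℝ) / 2 ^ N i < (k + 1 / 2 : ℝ) / 2 ^ N i := by gcongr; linarith
  have hlt2 : (k + 1 / 2 : ℝ) / 2 ^ N i < (k + 1 : ℝ) / 2 ^ N i := by gcongr; linarith
  rw [intervalIntegral.integral_sub (hint _ _) (hint' _ _),
    ← intervalIntegral.integral_add_adjacent_intervals (hint _ ((k + 1 / 2 : ℝ) / 2 ^ N i))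
      (hint _ _),
    intervalIntegral_eq_of_eqOn_Ico hlt1.le h₁, intervalIntegral_eq_of_eqOn_Ico hlt2.le h₂,
    intervalIntegral_eq_of_eqOn_Ico (hlt1.trans hlt2).le h]
  ring

/-- Both densities are bounded by `S`, so their difference is bounded by `W = 2 * S`. -/
theorem abs_integral_mul_stepDensity_refine_le {d : ℕ} {u f : E d → ℝ} {N : Fin d → ℕ} {i : Fin d}
    {S : ℝ} (hu : Integrable u volume) (huv : variation u < ⊤) (hS0 : 0 < S)
    (hS : ∀ x, |stepDensity f (Function.update N i (N i + 1)) x| ≤ S) :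
    |∫ x, u x * (stepDensity f (Function.update N i (N i + 1)) x - stepDensity f N x)|
      ≤ 2 * S / 2 ^ N i * (variation u).toReal := by
  refine abs_integral_mul_le_of_line_integrals (i := i) hu huv
    ((measurable_stepDensity f _).sub (measurable_stepDensity f _)) (by positivity) (fun x => ?_)
    (fun x hx => ?_) (integral_stepDensity_refine_sub hS0.le hS)
  · have h1 := hS x
    have h2 := abs_stepDensity_le_of_refine hS0.le hS x
    rw [abs_le] at *
    constructor <;> linarith
  · rw [stepDensity_of_notMem _ _ hx, stepDensity_of_notMem _ _ hx, sub_zero]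

/-- Telescoping over the coordinates: `s` is the set of directions already coarsened from level `n +
1` to level `n`, and each of the `d` steps costs one estimate for a single direction. -/
theorem abs_integral_mul_stepDensity_succ_sub_le {d : ℕ} {u f : E d → ℝ} {n : ℕ}
    {S : ℝ} (hu : Integrable u volume) (huv : variation u < ⊤) (hS0 : 0 < S)
    (hS : ∀ x, |stepDensity f (fun _ => n + 1) x| ≤ S) :
    |∫ x, u x * (stepDensity f (fun _ => n + 1) x - stepDensity f (fun _ => n) x)|
      ≤ d * (2 * S / 2 ^ n) * (variation u).toReal := by
  classical
  have key : ∀ s : Finset (Fin d),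
      (∀ x, |stepDensity f (fun i => if i ∈ s then n else n + 1) x| ≤ S) ∧
      |∫ x, u x * (stepDensity f (fun _ => n + 1) x
        - stepDensity f (fun i => if i ∈ s then n else n + 1) x)|
      ≤ s.card * (2 * S / 2 ^ n) * (variation u).toReal := by
    intro s
    induction s using Finset.induction_on with
    | empty => simpa using hS
    | insert i s his ih =>
      set N : Fin d → ℕ := fun j => if j ∈ insert i s then n else n + 1 with hN
      have hNi : N i = n := by simp [hN]
      have hup : (fun j => if j ∈ s then n else n + 1) = Function.update N i (N i + 1) := by
        funext j
        by_cases hj : j = i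
        · subst hj; simp [his, hNi]
        · simp [hj, hN]
      rw [hup] at ih
      have hb := abs_stepDensity_le_of_refine hS0.le ih.1
      refine ⟨hb, ?_⟩
      have h1 := abs_integral_mul_stepDensity_refine_le hu huv hS0 ih.1
      rw [hNi] at h1 ih
      have i1 := integrable_mul_of_bounded hu (measurable_stepDensity f _) hS
      have i2 := integrable_mul_of_bounded hu (measurable_stepDensity f _) ih.1
      have i3 := integrable_mul_of_bounded hu (measurable_stepDensity f _) hb
      have hsum : ∫ x, u x * (stepDensity f (fun _ => n + 1) x - stepDensity f N x)
          = (∫ x, u x * (stepDensity f (fun _ => n + 1) x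
            - stepDensity f (Function.update N i (n + 1)) x))
          + ∫ x, u x * (stepDensity f (Function.update N i (n + 1)) x - stepDensity f N x) := by
        simp only [mul_sub]
        rw [integral_sub i1 i3, integral_sub i1 i2, integral_sub i2 i3]
        ring
      rw [hsum, Finset.card_insert_of_notMem his]
      refine (abs_add_le _ _).trans ((add_le_add ih.2 h1).trans (le_of_eq ?_))
      push_cast
      ring
  simpa using (key Finset.univ).2

/-! ### Boxes and the integral of the step functions over them -/

theorem box_eq_preimage {d : ℕ} (a b : Fin d → ℝ) :
    box a b = WithLp.ofLp ⁻¹' (Set.univ.pi fun i => Set.Icc (a i) (b i)) := by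
  ext x
  exact ⟨fun h i _ => h i, fun h i => h i trivial⟩

theorem measurableSet_box {d : ℕ} (a b : Fin d → ℝ) : MeasurableSet (box a b) :=
  (isCompact_box a b).isClosed.measurableSet

theorem volume_real_box {d : ℕ} {a b : Fin d → ℝ} (hab : ∀ i, a i ≤ b i) :
    volume.real (box a b) = ∏ i, (b i - a i) := by
  rw [Measure.real, box_eq_preimage, (PiLp.volume_preserving_ofLp (Fin d)).measure_preimage
    (MeasurableSet.univ_pi fun i => measurableSet_Icc).nullMeasurableSet, Set.pi_univ_Icc,
    Real.volume_Icc_pi_toReal hab]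

theorem ae_coord_ne {d : ℕ} (c : Fin d → ℝ) : ∀ᵐ x : E d, ∀ i, x i ≠ c i := by
  rw [ae_all_iff]
  intro i
  exact (PiLp.volume_preserving_ofLp (Fin d)).quasiMeasurePreserving.ae
    (Measure.ae_eval_ne (fun _ : Fin d => (volume : Measure ℝ)) i (c i))

/-- The half-open box `∏ [a i, b i)`. -/
def halfOpenBox {d : ℕ} (a b : Fin d → ℝ) : Set (E d) := {x | ∀ i, a i ≤ x i ∧ x i < b i}

theorem halfOpenBox_ae_eq_box {d : ℕ} (a b : Fin d → ℝ) : halfOpenBox a b =ᵐ[volume] box a b := by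
  filter_upwards [ae_coord_ne b] with x hx
  refine propext ⟨fun h i => ⟨(h i).1, (h i).2.le⟩, fun h i => ⟨(h i).1, (h i).2.lt_of_ne (hx i)⟩⟩

theorem measurableSet_halfOpenBox {d : ℕ} (a b : Fin d → ℝ) : MeasurableSet (halfOpenBox a b) := by
  unfold halfOpenBox
  simp only [Set.ofPred_forall]
  refine MeasurableSet.iInter fun i => ?_
  have hm : Measurable fun x : E d => x i := by fun_prop
  exact (measurableSet_le measurable_const hm).inter (measurableSet_lt hm measurable_const)

/-- Expansion of a product of differences. It turns alternating sums over corners into products over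
coordinates, both for the summation by parts on the grid and for inclusion-exclusion on boxes. -/
theorem sum_neg_one_pow_mul_prod {d : ℕ} (p q : Fin d → ℝ) :
    ∑ s : Finset (Fin d), (-1 : ℝ) ^ s.card * ∏ i, (if i ∈ s then q i else p i)
      = ∏ i, (p i - q i) := by
  classical
  rw [Finset.prod_sub, Finset.powerset_univ]
  refine Finset.sum_congr rfl fun s _ => ?_
  rw [mul_assoc, Finset.prod_ite]
  congr 1
  rw [mul_comm]
  congr 2
  · ext; simp
  · simp

/-- The point of the grid of mesh `2^{-n}` below `y`. -/
noncomputable def gridPoint {d : ℕ} (n : ℕ) (y : E d) : E d :=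
  WithLp.toLp 2 (gridLower (fun _ => n) y)

theorem measurable_comp_gridPoint {d : ℕ} (F : E d → ℝ) (n : ℕ) :
    Measurable fun y => F (gridPoint n y) :=
  measurable_floor_comp (fun _ => n) fun k => F (WithLp.toLp 2 fun i => (k i : ℝ) / 2 ^ n)

/-- The translation vector with coordinates `δ` off `s` and `0` on `s`. -/
noncomputable def cornerShift {d : ℕ} (s : Finset (Fin d)) (δ : ℝ) : E d :=
  WithLp.toLp 2 fun i => if i ∈ s then 0 else δ

/-- Every corner of a cell is the lower corner of a translated cell, so a sum over corners can be
undone by a change of variables in the integral. -/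
theorem gridPoint_add_cornerShift {d : ℕ} (n : ℕ) (s : Finset (Fin d)) (y : E d) :
    gridPoint n (y + cornerShift s (1 / 2 ^ n)) = WithLp.toLp 2 (fun i =>
      if i ∈ s then gridLower (fun _ => n) y i else gridUpper (fun _ => n) y i) := by
  have h : (2 : ℝ) ^ n ≠ 0 := by positivity
  ext i
  simp only [gridPoint, gridLower, gridUpper, cornerShift, PiLp.add_apply]
  split_ifs with hi
  · rw [add_zero]
  · rw [mul_add, mul_one_div_cancel h, Int.floor_add_one]
    push_cast
    rfl

/-- In one coordinate, with `δ = 2^{-n}` and `a = k i / 2^n > 0`, the difference of indicators is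
that of `[a, a + δ)` minus that of `[0, δ)`. On the latter the grid point has a zero coordinate, so
`F` vanishes there. For `a = 0` both sides vanish, for the same reason on the right. -/
theorem comp_gridPoint_mul_prod_eq {d : ℕ} {F : E d → ℝ} (hF0 : ∀ x, (∃ i, x i = 0) → F x = 0)
    (n : ℕ) (k : Fin d → ℕ) (y : E d) :
    F (gridPoint n y) * ∏ i,
        ((Set.Ico 0 ((k i : ℝ) / 2 ^ n)).indicator (fun _ => (1 : ℝ)) (y i - 1 / 2 ^ n)
          - (Set.Ico 0 ((k i : ℝ) / 2 ^ n)).indicator (fun _ => (1 : ℝ)) (y i))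
      = (halfOpenBox (fun i => (k i : ℝ) / 2 ^ n) (fun i => ((k i : ℝ) + 1) / 2 ^ n)).indicator
        (fun _ => F (WithLp.toLp 2 fun i => (k i : ℝ) / 2 ^ n)) y := by
  classical
  have h2 : (0 : ℝ) < 2 ^ n := by positivity
  have hδ : (0 : ℝ) < 1 / 2 ^ n := by positivity
  by_cases hy : ∃ i, 0 ≤ y i ∧ y i < 1 / 2 ^ n
  · obtain ⟨i, hi0, hi1⟩ := hy
    have hz : F (gridPoint n y) = 0 := by
      refine hF0 _ ⟨i, ?_⟩
      have : ⌊2 ^ n * y i⌋ = 0 := floor_two_pow_mul (by simpa using hi0) (by simpa using hi1)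
      simp [gridPoint, gridLower, this]
    rw [hz, zero_mul]
    by_cases hm : y ∈ halfOpenBox (fun i => (k i : ℝ) / 2 ^ n) (fun i => ((k i : ℝ) + 1) / 2 ^ n)
    · rw [Set.indicator_of_mem hm]
      symm
      refine hF0 _ ⟨i, ?_⟩
      have h := (hm i).1.trans_lt hi1
      have hk : k i = 0 := by
        rw [div_lt_div_iff_of_pos_right h2] at h
        have : k i < 1 := by exact_mod_cast h
        omega
      simp [hk]
    · rw [Set.indicator_of_notMem hm]
  · push Not at hy
    have hfac : ∀ i, (Set.Ico 0 ((k i : ℝ) / 2 ^ n)).indicator (fun _ => (1 : ℝ)) (y i - 1 / 2 ^ n)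
          - (Set.Ico 0 ((k i : ℝ) / 2 ^ n)).indicator (fun _ => (1 : ℝ)) (y i)
        = if (k i : ℝ) / 2 ^ n ≤ y i ∧ y i < ((k i : ℝ) + 1) / 2 ^ n then 1 else 0 := by
      intro i
      have hk : (0 : ℝ) ≤ (k i : ℝ) / 2 ^ n := by positivity
      rw [add_div]
      simp only [Set.indicator_apply, Set.mem_Ico]
      have := hy i
      rcases lt_or_ge (y i) 0 with h0 | h0
      · rw [if_neg, if_neg, if_neg, sub_zero]
        all_goals (rintro ⟨h1, h2⟩; linarith)
      · have h1 := this h0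
        by_cases ha : y i < (k i : ℝ) / 2 ^ n
        · rw [if_pos ⟨by linarith, by linarith⟩, if_pos ⟨h0, ha⟩, if_neg, sub_self]
          rintro ⟨h1, h2⟩; linarith
        · rw [if_neg (c := 0 ≤ y i ∧ _) (fun h => ha h.2)]
          by_cases hb : y i < (k i : ℝ) / 2 ^ n + 1 / 2 ^ n
          · rw [if_pos ⟨by linarith, by linarith⟩, if_pos ⟨not_lt.1 ha, hb⟩, sub_zero]
          · rw [if_neg, if_neg (fun h => hb h.2), sub_zero]
            rintro ⟨_, h3⟩
            exact hb (by linarith)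
    simp_rw [hfac]
    rw [Fintype.prod_ite_zero]
    by_cases hm : y ∈ halfOpenBox (fun i => (k i : ℝ) / 2 ^ n) (fun i => ((k i : ℝ) + 1) / 2 ^ n)
    · rw [Set.indicator_of_mem hm, if_pos (by exact hm)]
      rw [Finset.prod_const_one, mul_one]
      congr 1
      ext i
      have : ⌊2 ^ n * y i⌋ = (k i : ℤ) :=
        floor_two_pow_mul (by simpa using (hm i).1) (by simpa using (hm i).2)
      simp [gridPoint, gridLower, this]
    · rw [Set.indicator_of_notMem hm, if_neg (by exact hm), mul_zero]

/-- Summation by parts: translating each corner term moves the differences from `F` to the indicator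
of the box. What remains is `F` at the upper corner of the box on one cell, whose volume cancels the
normalising factor `(2 ^ n) ^ d`. -/
theorem integral_box_stepDensity {d : ℕ} {F : E d → ℝ} {M : ℝ} (hFM : ∀ x, |F x| ≤ M)
    (hF0 : ∀ x, (∃ i, x i = 0) → F x = 0) (n : ℕ) (k : Fin d → ℕ) (hk : ∀ i, k i ≤ 2 ^ n) :
    ∫ y in box (fun _ => 0) (fun i => (k i : ℝ) / 2 ^ n), stepDensity F (fun _ => n) y
      = F (WithLp.toLp 2 fun i => (k i : ℝ) / 2 ^ n) := by
  classical
  have h2 : (0 : ℝ) < 2 ^ n := by positivity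
  set A : Set (E d) := halfOpenBox (fun _ => 0) (fun i => (k i : ℝ) / 2 ^ n) with hA
  have hAm : MeasurableSet A := measurableSet_halfOpenBox _ _
  have hAQ : A ⊆ halfOpenCube d := fun y hy i => ⟨(hy i).1, (hy i).2.trans_le (by
    rw [div_le_one h2]; exact_mod_cast hk i)⟩
  have hAfin : volume A ≠ ∞ :=
    ((measure_mono (hAQ.trans (halfOpenCube_subset d))).trans_lt (volume_unitCube_lt_top d)).ne
  let p : Fin d → ℝ → ℝ := fun i => (Set.Ico 0 ((k i : ℝ) / 2 ^ n)).indicator fun _ => (1 : ℝ)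
  have hp : ∀ y : E d, A.indicator (fun _ => (1 : ℝ)) y = ∏ i, p i (y i) := by
    intro y
    simp only [p, Set.indicator_apply, Set.mem_Ico]
    rw [Fintype.prod_ite_zero, Finset.prod_const_one]
    by_cases hy : y ∈ A
    · rw [if_pos hy, if_pos (by exact hy)]
    · rw [if_neg hy, if_neg (by exact hy)]
  have hint : ∀ (G : E d → ℝ), Measurable G → (∀ x, |G x| ≤ M) →
      Integrable (fun y => A.indicator (fun _ => (1 : ℝ)) y * G y) volume := by
    intro G hG hGM
    refine integrable_mul_of_bounded ?_ hG hGM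
    exact (integrable_indicator_iff hAm).2 (integrableOn_const hAfin)
  have hterm : ∀ s : Finset (Fin d),
      ∫ y, A.indicator (fun _ => (1 : ℝ)) y * F (gridPoint n (y + cornerShift s (1 / 2 ^ n)))
      = ∫ y, F (gridPoint n y) * ∏ i, (if i ∈ s then p i (y i) else p i (y i - 1 / 2 ^ n)) := by
    intro s
    rw [← integral_sub_right_eq_self _ (cornerShift s (1 / 2 ^ n))]
    refine integral_congr_ae (Eventually.of_forall fun y => ?_)
    simp only [sub_add_cancel, hp]
    rw [mul_comm]
    congr 1
    refine Finset.prod_congr rfl fun i _ => ?_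
    simp only [PiLp.sub_apply, cornerShift]
    split_ifs <;> simp
  have hmeas : ∀ s : Finset (Fin d),
      Measurable fun y : E d => F (gridPoint n (y + cornerShift s (1 / 2 ^ n))) :=
    fun s => (measurable_comp_gridPoint F n).comp (measurable_id.add_const _)
  have hterm_int : ∀ s : Finset (Fin d), Integrable (fun y =>
      F (gridPoint n y) * ∏ i, (if i ∈ s then p i (y i) else p i (y i - 1 / 2 ^ n))) volume := by
    intro s
    have h := (hint _ (hmeas s) (fun _ => hFM _)).comp_sub_right (cornerShift s (1 / 2 ^ n))
    refine h.congr (Eventually.of_forall fun y => ?_)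
    simp only [sub_add_cancel, hp]
    rw [mul_comm]
    congr 1
    refine Finset.prod_congr rfl fun i _ => ?_
    simp only [PiLp.sub_apply, cornerShift]
    split_ifs <;> simp
  have hstart : ∀ y, A.indicator (stepDensity F fun _ => n) y
      = ∑ s : Finset (Fin d), (2 ^ n) ^ d * ((-1 : ℝ) ^ s.card *
        (A.indicator (fun _ => (1 : ℝ)) y * F (gridPoint n (y + cornerShift s (1 / 2 ^ n))))) := by
    intro y
    by_cases hy : y ∈ A
    · rw [Set.indicator_of_mem hy, Set.indicator_of_mem hy, stepDensity,
        Set.indicator_of_mem (hAQ hy), increment, Finset.prod_const, Finset.card_univ,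
        Fintype.card_fin, Finset.mul_sum]
      refine Finset.sum_congr rfl fun s _ => ?_
      rw [gridPoint_add_cornerShift, one_mul]
    · rw [Set.indicator_of_notMem hy, Set.indicator_of_notMem hy]
      simp
  rw [← setIntegral_congr_set (halfOpenBox_ae_eq_box _ _), ← hA, ← integral_indicator hAm]
  simp_rw [hstart]
  rw [integral_finsetSum _ fun s _ => ((hint _ (hmeas s) fun _ => hFM _).const_mul _).const_mul _]
  simp_rw [integral_const_mul, hterm, ← integral_const_mul]
  rw [← integral_finsetSum _ fun s _ => ((hterm_int s).const_mul _).const_mul _]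
  have hend : ∀ y : E d, ∑ s : Finset (Fin d), (2 ^ n : ℝ) ^ d * ((-1 : ℝ) ^ s.card *
      (F (gridPoint n y) * ∏ i, (if i ∈ s then p i (y i) else p i (y i - 1 / 2 ^ n))))
      = (2 ^ n) ^ d * (halfOpenBox (fun i => (k i : ℝ) / 2 ^ n)
        (fun i => ((k i : ℝ) + 1) / 2 ^ n)).indicator
        (fun _ => F (WithLp.toLp 2 fun i => (k i : ℝ) / 2 ^ n)) y := by
    intro y
    rw [← comp_gridPoint_mul_prod_eq hF0 n k y, ← sum_neg_one_pow_mul_prod, Finset.mul_sum,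
      Finset.mul_sum]
    refine Finset.sum_congr rfl fun s _ => ?_
    ring
  simp_rw [hend]
  rw [integral_const_mul, integral_indicator (measurableSet_halfOpenBox _ _), setIntegral_const,
    measureReal_congr (halfOpenBox_ae_eq_box _ _), volume_real_box fun i => by gcongr; linarith]
  have : ∀ i, ((k i : ℝ) + 1) / 2 ^ n - (k i : ℝ) / 2 ^ n = 1 / 2 ^ n := fun i => by ring
  simp_rw [this]
  rw [Finset.prod_const, Finset.card_univ, Fintype.card_fin, smul_eq_mul, ← mul_assoc, ← mul_pow,
    mul_one_div_cancel h2.ne', one_pow, one_mul]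

/-! ### Perimeter of boxes, and linear combinations of sets -/

theorem IsTestField.continuous_divergence {d : ℕ} {v : E d → E d} (hv : IsTestField v) :
    Continuous (divergence v) := by
  have hcf : Continuous (fderiv ℝ v) := hv.1.continuous_fderiv one_ne_zero
  unfold divergence
  fun_prop

/-- Divergence theorem: there are `2 * d` faces, each of area at most `1`, and the normal component
of `v` is at most `1` in absolute value. -/
theorem setIntegral_box_divergence_le {d : ℕ} {a b : Fin d → ℝ} (ha : ∀ i, 0 ≤ a i)
    (hab : ∀ i, a i ≤ b i) (hb : ∀ i, b i ≤ 1) {v : E d → E d} (hv : IsTestField v) :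
    ∫ x in box a b, divergence v x ≤ 2 * d := by
  cases d with
  | zero => simp [divergence]
  | succ n =>
    have hdiff : Differentiable ℝ v := hv.1.differentiable one_ne_zero
    let L : (Fin (n + 1) → ℝ) →L[ℝ] E (n + 1) :=
      ((EuclideanSpace.equiv (Fin (n + 1)) ℝ).symm : (Fin (n + 1) → ℝ) →L[ℝ] E (n + 1))
    have hpre : (WithLp.toLp 2 : (Fin (n + 1) → ℝ) → E (n + 1)) ⁻¹' box a b = Set.Icc a b := by
      ext y
      exact ⟨fun h => ⟨fun i => (h i).1, fun i => (h i).2⟩, fun h i => ⟨h.1 i, h.2 i⟩⟩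
    have hemb : MeasurableEmbedding (WithLp.toLp 2 : (Fin (n + 1) → ℝ) → E (n + 1)) :=
      (MeasurableEquiv.toLp 2 (Fin (n + 1) → ℝ)).measurableEmbedding
    rw [← (PiLp.volume_preserving_toLp (Fin (n + 1))).setIntegral_preimage_emb hemb, hpre]
    have hD : ∀ (i : Fin (n + 1)) (y : Fin (n + 1) → ℝ),
        HasFDerivAt (fun y => (v (L y)) i)
          ((EuclideanSpace.proj i : E (n + 1) →L[ℝ] ℝ) ∘L fderiv ℝ v (L y) ∘L L) y := by
      intro i y
      exact (EuclideanSpace.proj i : E (n + 1) →L[ℝ] ℝ).hasFDerivAt.comp y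
        ((hdiff (L y)).hasFDerivAt.comp y L.hasFDerivAt)
    have hdiv : ∀ y : Fin (n + 1) → ℝ, divergence v (WithLp.toLp 2 y)
        = ∑ i, ((EuclideanSpace.proj i : E (n + 1) →L[ℝ] ℝ) ∘L fderiv ℝ v (L y) ∘L L)
          (Pi.single i 1) := by
      intro y
      rfl
    have hcont : Continuous fun y : Fin (n + 1) → ℝ => divergence v (WithLp.toLp 2 y) :=
      hv.continuous_divergence.comp (PiLp.continuous_toLp 2 _)
    have hthm := integral_divergence_of_hasFDerivAt_off_countable' a b hab
      (fun i y => (v (L y)) i) (fun i y =>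
        (EuclideanSpace.proj i : E (n + 1) →L[ℝ] ℝ) ∘L fderiv ℝ v (L y) ∘L L) ∅
      Set.countable_empty
      (fun i => (continuous_iff_continuousAt.2 fun y => (hD i y).continuousAt).continuousOn)
      (fun y _ i => hD i y)
      (by simp_rw [← hdiv]; exact hcont.continuousOn.integrableOn_compact isCompact_Icc)
    simp_rw [hdiv]
    rw [hthm]
    have hface : ∀ (i : Fin (n + 1)) (c : ℝ),
        |∫ x in Set.Icc (a ∘ i.succAbove) (b ∘ i.succAbove), (v (L (i.insertNth c x))) i| ≤ 1 := by
      intro i c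
      have hfin : volume (Set.Icc (a ∘ i.succAbove) (b ∘ i.succAbove)) < ∞ :=
        isCompact_Icc.measure_lt_top
      refine (norm_setIntegral_le_of_norm_le_const (C := 1) hfin fun x _ =>
        (PiLp.norm_apply_le _ _).trans (hv.2.2 _)).trans ?_
      rw [one_mul, Measure.real, Real.volume_Icc_pi_toReal (a := a ∘ i.succAbove)
        (b := b ∘ i.succAbove) fun j => hab _]
      refine Finset.prod_le_one (fun j _ => sub_nonneg.2 (hab _)) fun j _ => ?_
      have h1 := ha (i.succAbove j)
      have h2 := hb (i.succAbove j)
      simp only [Function.comp]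
      linarith
    calc _ ≤ ∑ _i : Fin (n + 1), (2 : ℝ) := Finset.sum_le_sum fun i _ => by
          have h1 := abs_le.1 (hface i (b i))
          have h2 := abs_le.1 (hface i (a i))
          linarith [h1.2, h2.1]
      _ = 2 * ((n + 1 : ℕ) : ℝ) := by simp [mul_comm]

theorem perimeter_box_le {d : ℕ} {a b : Fin d → ℝ} (ha : ∀ i, 0 ≤ a i)
    (hab : ∀ i, a i ≤ b i) (hb : ∀ i, b i ≤ 1) :
    perimeter (box a b) ≤ ENNReal.ofReal (2 * d) := by
  refine iSup₂_le fun v hv => ENNReal.ofReal_le_ofReal ?_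
  refine le_trans (le_of_eq ?_) (setIntegral_box_divergence_le ha hab hb hv)
  rw [← integral_indicator (measurableSet_box a b)]
  refine integral_congr_ae (Eventually.of_forall fun x => ?_)
  by_cases hx : x ∈ box a b
  · simp [Set.indicator_of_mem hx]
  · simp [Set.indicator_of_notMem hx]

theorem isBVSet_box {d : ℕ} {a b : Fin d → ℝ} (ha : ∀ i, 0 ≤ a i)
    (hab : ∀ i, a i ≤ b i) (hb : ∀ i, b i ≤ 1) : IsBVSet (box a b) where
  subset _ hx i := ⟨(ha i).trans (hx i).1, (hx i).2.trans (hb i)⟩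
  measurable := (measurableSet_box a b).nullMeasurableSet
  perimeter_lt_top := (perimeter_box_le ha hab hb).trans_lt ENNReal.ofReal_lt_top

theorem coeFn_toL1_indicator {d : ℕ} {B : Set (E d)} (hB : IsBVSet B) :
    (BV.toL1 hB.indicator : E d → ℝ) =ᵐ[volume] B.indicator fun _ => (1 : ℝ) :=
  hB.memLp.coeFn_toLp

theorem coeFn_toL1_sum_indicator {d : ℕ} {ι : Type*} (s : Finset ι) (c : ι → ℝ)
    {B : ι → Set (E d)} (hB : ∀ j, IsBVSet (B j)) :
    (BV.toL1 (∑ j ∈ s, c j • (hB j).indicator) : E d → ℝ)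
      =ᵐ[volume] fun x => ∑ j ∈ s, c j * (B j).indicator (fun _ => (1 : ℝ)) x := by
  classical
  induction s using Finset.induction_on with
  | empty =>
    simp only [Finset.sum_empty, map_zero]
    exact Lp.coeFn_zero ℝ 1 volume
  | insert j s hj ih =>
    simp only [Finset.sum_insert hj, map_add, map_smul]
    filter_upwards [ih, Lp.coeFn_add (c j • BV.toL1 (hB j).indicator)
      (BV.toL1 (∑ j ∈ s, c j • (hB j).indicator)), Lp.coeFn_smul (c j) (BV.toL1 (hB j).indicator),
      coeFn_toL1_indicator (hB j)] with x h1 h2 h3 h4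
    rw [h2, Pi.add_apply, h1, h3, Pi.smul_apply, h4, smul_eq_mul]

/-- A set whose indicator is almost everywhere a linear combination of indicators of `BV`-sets has
finite perimeter. -/
theorem isBVSet_of_indicator_ae_eq {d : ℕ} {ι : Type*} [Fintype ι] (c : ι → ℝ)
    {B : ι → Set (E d)} (hB : ∀ j, IsBVSet (B j)) {A : Set (E d)} (hA : A ⊆ unitCube d)
    (hAm : NullMeasurableSet A volume)
    (h : (A.indicator fun _ => (1 : ℝ)) =ᵐ[volume]
      fun x => ∑ j, c j * (B j).indicator (fun _ => (1 : ℝ)) x) : IsBVSet A := by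
  refine ⟨hA, hAm, ?_⟩
  rw [perimeter, variation_congr (h.trans (coeFn_toL1_sum_indicator Finset.univ c hB).symm)]
  exact BV.variation_lt_top _

/-- The elements of `BV` are classes modulo null sets, so an identity of indicators almost
everywhere can be fed to any linear functional on `BV`. -/
theorem indicator_eq_sum {d : ℕ} {ι : Type*} [Fintype ι] (c : ι → ℝ)
    {B : ι → Set (E d)} (hB : ∀ j, IsBVSet (B j)) {A : Set (E d)} (hA : IsBVSet A)
    (h : (A.indicator fun _ => (1 : ℝ)) =ᵐ[volume]
      fun x => ∑ j, c j * (B j).indicator (fun _ => (1 : ℝ)) x) :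
    hA.indicator = ∑ j, c j • (hB j).indicator :=
  BV.toL1_injective (Lp.ext
    ((coeFn_toL1_indicator hA).trans (h.trans (coeFn_toL1_sum_indicator Finset.univ c hB).symm)))

theorem indicator_iUnion_ae_eq {d : ℕ} {ι : Type*} [Fintype ι] {B : ι → Set (E d)}
    (hB : ∀ j k, j ≠ k → volume (B j ∩ B k) = 0) :
    ((⋃ j, B j).indicator fun _ => (1 : ℝ)) =ᵐ[volume]
      fun x => ∑ j, 1 * (B j).indicator (fun _ => (1 : ℝ)) x := by
  classical
  have h : ∀ᵐ x ∂(volume : Measure (E d)), ∀ j k, j ≠ k → ¬ (x ∈ B j ∩ B k) := by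
    simp only [ae_all_iff]
    intro j k hjk
    exact measure_eq_zero_iff_ae_notMem.1 (hB j k hjk)
  filter_upwards [h] with x hx
  by_cases hu : x ∈ ⋃ j, B j
  · obtain ⟨j, hj⟩ := Set.mem_iUnion.1 hu
    rw [Set.indicator_of_mem hu, Finset.sum_eq_single j]
    · rw [Set.indicator_of_mem hj, one_mul]
    · intro k _ hk
      rw [Set.indicator_of_notMem (fun h => hx k j hk ⟨h, hj⟩), mul_zero]
    · simp
  · rw [Set.indicator_of_notMem hu, Finset.sum_eq_zero]
    intro j _
    rw [Set.indicator_of_notMem (fun h => hu (Set.mem_iUnion.2 ⟨j, h⟩)), mul_zero]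

/-- Inclusion-exclusion for the indicator of a box. -/
theorem indicator_box_ae_eq {d : ℕ} {a b : Fin d → ℝ} (ha : ∀ i, 0 ≤ a i) (hab : ∀ i, a i ≤ b i) :
    ((box a b).indicator fun _ => (1 : ℝ)) =ᵐ[volume]
      fun x => ∑ s : Finset (Fin d), (-1 : ℝ) ^ s.card *
        (box (fun _ => 0) (fun i => if i ∈ s then a i else b i)).indicator (fun _ => (1 : ℝ)) x := by
  classical
  have hbox : ∀ (p q : Fin d → ℝ) (x : E d), (box p q).indicator (fun _ => (1 : ℝ)) x
      = ∏ i, if p i ≤ x i ∧ x i ≤ q i then (1 : ℝ) else 0 := by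
    intro p q x
    rw [Fintype.prod_ite_zero, Finset.prod_const_one]
    by_cases hx : x ∈ box p q
    · rw [Set.indicator_of_mem hx, if_pos (by exact hx)]
    · rw [Set.indicator_of_notMem hx, if_neg (by exact hx)]
  -- Removing `[0, a i]` from `[0, b i]` leaves `(a i, b i]`, which differs from the closed edge
  -- only at `a i`.
  filter_upwards [ae_coord_ne a] with x hx
  have h1 : ∀ s : Finset (Fin d), ∏ i, (if 0 ≤ x i ∧ x i ≤ (if i ∈ s then a i else b i) then
      (1 : ℝ) else 0) = ∏ i, (if i ∈ s then (if 0 ≤ x i ∧ x i ≤ a i then (1 : ℝ) else 0)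
        else (if 0 ≤ x i ∧ x i ≤ b i then (1 : ℝ) else 0)) := by
    intro s
    refine Finset.prod_congr rfl fun i _ => ?_
    by_cases hi : i ∈ s <;> simp [hi]
  simp_rw [hbox, h1]
  rw [sum_neg_one_pow_mul_prod]
  refine Finset.prod_congr rfl fun i _ => ?_
  have h2 := ha i
  have h3 := hab i
  rcases lt_or_gt_of_ne (hx i) with h | h
  · rw [if_neg (fun hh => absurd hh.1 (not_le.2 h))]
    by_cases h0 : 0 ≤ x i
    · rw [if_pos ⟨h0, by linarith⟩, if_pos ⟨h0, h.le⟩, sub_self]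
    · rw [if_neg (fun hh => h0 hh.1), if_neg (fun hh => h0 hh.1), sub_self]
  · rw [if_neg (c := 0 ≤ x i ∧ x i ≤ a i) (fun hh => absurd hh.2 (not_le.2 h)), sub_zero]
    refine if_congr ⟨fun hh => ⟨h2.trans hh.1, hh.2⟩, fun hh => ⟨h.le, hh.2⟩⟩ rfl rfl

/-! ### Functionals given by bounded densities, and their limits -/

/-- Only the `L¹` norm appears on the right. This is stronger than continuity on `BV`, and it is
what makes the limit functional continuous along sequences of sets. -/
theorem abs_integral_unitCube_mul_le {d : ℕ} {g : E d → ℝ} {W : ℝ}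
    (hW : ∀ x, |g x| ≤ W) (u : BV d) : |∫ x in unitCube d, g x * BV.toL1 u x| ≤ W * ‖BV.toL1 u‖ := by
  have hW0 : 0 ≤ W := (abs_nonneg _).trans (hW 0)
  have h1 : ‖∫ x in unitCube d, g x * BV.toL1 u x‖
      ≤ ∫ x in unitCube d, W * ‖BV.toL1 u x‖ :=
    norm_integral_le_of_norm_le ((L1.integrable_coeFn _).norm.const_mul W).integrableOn
      (Eventually.of_forall fun x => by
        rw [norm_mul]
        exact mul_le_mul_of_nonneg_right (hW x) (norm_nonneg _))
  refine h1.trans ?_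
  rw [integral_const_mul, L1.norm_eq_integral_norm]
  exact mul_le_mul_of_nonneg_left (setIntegral_le_integral (L1.integrable_coeFn _).norm
    (Eventually.of_forall fun x => norm_nonneg _)) hW0

/-- The functional `u ↦ ∫_{[0,1]^d} g u` for a bounded measurable function `g`. -/
noncomputable def pairing {d : ℕ} (g : E d → ℝ) (hg : Measurable g) (W : ℝ)
    (hW : ∀ x, |g x| ≤ W) : StrongDual ℝ (BV d) :=
  LinearMap.mkContinuous
    { toFun := fun u => ∫ x in unitCube d, g x * BV.toL1 u x
      map_add' := fun u w => by
        have hi : ∀ u : BV d, Integrable (fun x => g x * BV.toL1 u x)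
            (volume.restrict (unitCube d)) := fun u => by
          simp_rw [mul_comm (g _)]
          exact (integrable_mul_of_bounded (L1.integrable_coeFn _) hg hW).integrableOn
        rw [← integral_add (hi u) (hi w), map_add]
        refine integral_congr_ae (ae_restrict_of_ae ?_)
        filter_upwards [Lp.coeFn_add (BV.toL1 u) (BV.toL1 w)] with x hx
        rw [hx, Pi.add_apply, mul_add]
      map_smul' := fun c u => by
        rw [RingHom.id_apply, smul_eq_mul, ← integral_const_mul, map_smul]
        refine integral_congr_ae (ae_restrict_of_ae ?_)
        filter_upwards [Lp.coeFn_smul c (BV.toL1 u)] with x hx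
        rw [hx, Pi.smul_apply, smul_eq_mul]
        ring } W fun u => by
      refine (abs_integral_unitCube_mul_le hW u).trans
        (mul_le_mul_of_nonneg_left ?_ ((abs_nonneg _).trans (hW 0)))
      rw [BV.norm_def]
      exact le_add_of_nonneg_right ENNReal.toReal_nonneg

theorem pairing_apply {d : ℕ} {g : E d → ℝ} (hg : Measurable g) {W : ℝ}
    (hW : ∀ x, |g x| ≤ W) (u : BV d) :
    pairing g hg W hW u = ∫ x in unitCube d, g x * BV.toL1 u x := rfl

theorem pairing_mem_rangeT {d : ℕ} {g : E d → ℝ} (hg : Measurable g) {W : ℝ}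
    (hW : ∀ x, |g x| ≤ W) : pairing g hg W hW ∈ rangeT d := by
  have : IsFiniteMeasure (volume.restrict (unitCube d)) :=
    ⟨by rw [Measure.restrict_apply_univ]; exact volume_unitCube_lt_top d⟩
  exact ⟨g, MemLp.of_bound hg.aestronglyMeasurable W (Eventually.of_forall hW), fun u => rfl⟩

theorem abs_pairing_le {d : ℕ} {g : E d → ℝ} (hg : Measurable g) {W : ℝ}
    (hW : ∀ x, |g x| ≤ W) (u : BV d) : |pairing g hg W hW u| ≤ W * ‖BV.toL1 u‖ :=
  abs_integral_unitCube_mul_le hW u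

theorem pairing_indicator {d : ℕ} {g : E d → ℝ} (hg : Measurable g) {W : ℝ}
    (hW : ∀ x, |g x| ≤ W) {B : Set (E d)} (hB : IsBVSet B) (hBm : MeasurableSet B) :
    pairing g hg W hW hB.indicator = ∫ x in B, g x := by
  rw [pairing_apply, ← integral_indicator hBm, ← integral_indicator
    (show MeasurableSet (unitCube d) from measurableSet_box _ _)]
  refine integral_congr_ae ?_
  filter_upwards [coeFn_toL1_indicator hB] with x hx
  by_cases hxB : x ∈ B
  · rw [Set.indicator_of_mem (hB.subset hxB), hx, Set.indicator_of_mem hxB,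
      Set.indicator_of_mem hxB, mul_one]
  · rw [Set.indicator_of_notMem hxB]
    by_cases hxQ : x ∈ unitCube d
    · rw [Set.indicator_of_mem hxQ, hx, Set.indicator_of_notMem hxB, mul_zero]
    · rw [Set.indicator_of_notMem hxQ]

open Classical in
/-- The set function `B ↦ α(1_B)`. -/
noncomputable def chargeOf {d : ℕ} (α : StrongDual ℝ (BV d)) (B : Set (E d)) : ℝ :=
  if hB : IsBVSet B then α hB.indicator else 0

theorem chargeOf_apply {d : ℕ} (α : StrongDual ℝ (BV d)) {B : Set (E d)} (hB : IsBVSet B) :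
    chargeOf α B = α hB.indicator := dif_pos hB

theorem chargeOf_eq_sum {d : ℕ} (α : StrongDual ℝ (BV d)) {ι : Type*} [Fintype ι] (c : ι → ℝ)
    {B : ι → Set (E d)} (hB : ∀ j, IsBVSet (B j)) {A : Set (E d)} (hA : IsBVSet A)
    (h : (A.indicator fun _ => (1 : ℝ)) =ᵐ[volume]
      fun x => ∑ j, c j * (B j).indicator (fun _ => (1 : ℝ)) x) :
    chargeOf α A = ∑ j, c j * chargeOf α (B j) := by
  rw [chargeOf_apply α hA, indicator_eq_sum c hB hA h, map_sum]
  refine Finset.sum_congr rfl fun j _ => ?_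
  rw [map_smul, smul_eq_mul, chargeOf_apply]

theorem chargeOf_iUnion {d : ℕ} (α : StrongDual ℝ (BV d)) {ι : Type*} [Fintype ι]
    {B : ι → Set (E d)} (hB : ∀ j, IsBVSet (B j))
    (hd : ∀ j k, j ≠ k → volume (B j ∩ B k) = 0) :
    chargeOf α (⋃ j, B j) = ∑ j, chargeOf α (B j) := by
  have h := indicator_iUnion_ae_eq hd
  have hA : IsBVSet (⋃ j, B j) := isBVSet_of_indicator_ae_eq _ hB
    (Set.iUnion_subset fun j => (hB j).subset)
    (NullMeasurableSet.iUnion fun j => (hB j).measurable) h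
  rw [chargeOf_eq_sum α _ hB hA h]
  simp

theorem norm_toL1_indicator_le {d : ℕ} {B : Set (E d)} (hB : IsBVSet B) :
    ‖BV.toL1 hB.indicator‖ ≤ volume.real (unitCube d) := by
  have hQ : MeasurableSet (unitCube d) := measurableSet_box _ _
  rw [L1.norm_eq_integral_norm, ← integral_indicator_one hQ]
  refine integral_mono_ae (L1.integrable_coeFn _).norm
    ((integrable_indicator_iff hQ).2 (integrableOn_const (volume_unitCube_lt_top d).ne)) ?_
  filter_upwards [coeFn_toL1_indicator hB] with x hx
  rw [hx]
  by_cases hxB : x ∈ B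
  · rw [Set.indicator_of_mem hxB, Set.indicator_of_mem (hB.subset hxB)]
    simp
  · rw [Set.indicator_of_notMem hxB, norm_zero]
    exact Set.indicator_nonneg (fun _ _ => zero_le_one) _

theorem norm_toL1_indicator_sub {d : ℕ} {A B : Set (E d)} (hA : IsBVSet A) (hB : IsBVSet B) :
    ‖BV.toL1 (hA.indicator - hB.indicator)‖ = volume.real (symmDiff A B) := by
  have hm : NullMeasurableSet (symmDiff A B) volume := by
    rw [Set.symmDiff_def]
    exact (hA.measurable.diff hB.measurable).union (hB.measurable.diff hA.measurable)
  rw [L1.norm_eq_integral_norm]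
  have h1 : ∫ x, (symmDiff A B).indicator (fun _ => (1 : ℝ)) x = volume.real (symmDiff A B) := by
    rw [integral_indicator₀ hm, setIntegral_const, smul_eq_mul, mul_one]
  rw [← h1]
  refine integral_congr_ae ?_
  rw [map_sub]
  filter_upwards [coeFn_toL1_indicator hA, coeFn_toL1_indicator hB,
    Lp.coeFn_sub (BV.toL1 hA.indicator) (BV.toL1 hB.indicator)] with x h2 h3 h4
  rw [h4, Pi.sub_apply, h2, h3]
  by_cases hxA : x ∈ A <;> by_cases hxB : x ∈ B <;>
    simp [Set.mem_symmDiff, hxA, hxB]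

theorem norm_indicator_le {d : ℕ} {B : Set (E d)} (hB : IsBVSet B) {P : ℝ≥0∞} (hP : P < ∞)
    (hBP : perimeter B ≤ P) : ‖hB.indicator‖ ≤ volume.real (unitCube d) + P.toReal := by
  rw [BV.norm_def]
  refine add_le_add (norm_toL1_indicator_le hB) (ENNReal.toReal_mono hP.ne ?_)
  rw [variation_congr (coeFn_toL1_indicator hB)]
  exact hBP

/-- Norm limits of functionals with bounded densities define charges. -/
theorem isCharge_chargeOf {d : ℕ} {α : StrongDual ℝ (BV d)}
    (hα : ∀ ε > 0, ∃ (g : E d → ℝ) (hg : Measurable g) (W : ℝ) (hW : ∀ x, |g x| ≤ W),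
      ‖α - pairing g hg W hW‖ < ε) : IsCharge (chargeOf α) where
  additive B₁ B₂ h₁ h₂ h := by
    rw [Set.union_eq_iUnion, chargeOf_iUnion α (B := fun b : Bool => cond b B₁ B₂)
      (fun b => by cases b <;> assumption)]
    · simp
    · intro j k hjk
      cases j <;> cases k
      · exact absurd rfl hjk
      · simpa [Set.inter_comm] using h
      · simpa using h
      · exact absurd rfl hjk
  continuous B B' hB hB' hP hlim := by
    -- One number bounds the perimeters of all the sets and of their limit; the `+ 1` in `R` below
    -- makes it safe to divide by.
    set P := (⨆ n, perimeter (B n)) + perimeter B' with hPdef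
    have hPfin : P < ∞ := ENNReal.add_lt_top.2 ⟨hP, hB'.perimeter_lt_top⟩
    set R : ℝ := 2 * (volume.real (unitCube d) + P.toReal) + 1 with hR
    have hR0 : 0 < R := by
      have h1 : 0 ≤ volume.real (unitCube d) := measureReal_nonneg
      have h2 : 0 ≤ P.toReal := ENNReal.toReal_nonneg
      linarith
    have hnorm : ∀ n, ‖(hB n).indicator - hB'.indicator‖ ≤ R := by
      intro n
      have h1 := norm_indicator_le (hB n) hPfin
        ((le_iSup (fun n => perimeter (B n)) n).trans le_self_add)
      have h2 := norm_indicator_le hB' hPfin le_add_self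
      refine (norm_sub_le _ _).trans ?_
      linarith
    rw [Metric.tendsto_atTop]
    intro ε hε
    -- The differences of indicators have `BV` norm at most `R`, so replacing `α` by the pairing
    -- costs at most `ε / 2`. The pairing itself tends to `0` because it is controlled by `|B n ∆
    -- B'|`.
    obtain ⟨g, hg, W, hW, hgα⟩ := hα (ε / (2 * R)) (by positivity)
    have hW0 : 0 ≤ W := (abs_nonneg _).trans (hW 0)
    have hlim' : Tendsto (fun n => W * volume.real (symmDiff (B n) B')) atTop (𝓝 0) := by
      have := ((ENNReal.tendsto_toReal ENNReal.zero_ne_top).comp hlim).const_mul W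
      simpa [Measure.real] using this
    obtain ⟨n₀, hn₀⟩ := (Metric.tendsto_atTop.1 hlim') (ε / 2) (by positivity)
    refine ⟨n₀, fun n hn => ?_⟩
    rw [chargeOf_apply α (hB n), chargeOf_apply α hB', Real.dist_eq, ← map_sub]
    set u := (hB n).indicator - hB'.indicator with hu
    have e1 : |pairing g hg W hW u| < ε / 2 := by
      refine (abs_pairing_le hg hW u).trans_lt ?_
      rw [hu, norm_toL1_indicator_sub]
      have := hn₀ n hn
      rw [Real.dist_eq, sub_zero] at this
      exact (le_abs_self _).trans_lt this
    have e2 : |(α - pairing g hg W hW) u| ≤ ε / 2 := by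
      refine ((α - pairing g hg W hW).le_opNorm u).trans ?_
      calc _ ≤ ε / (2 * R) * R := mul_le_mul hgα.le (hnorm n) (norm_nonneg _) (by positivity)
        _ = ε / 2 := by field_simp
    have e3 : α u = (α - pairing g hg W hW) u + pairing g hg W hW u := by
      simp
    rw [e3]
    exact (abs_add_le _ _).trans_lt (by linarith)

/-- The estimate by the variation alone bounds the dual norm, since the variation is one of the two
terms of the `BV` norm. -/
theorem norm_pairing_stepDensity_sub_le {d : ℕ} {F : E d → ℝ} {n : ℕ} {S S' : ℝ} (hS0 : 0 < S')
    (hS : ∀ x, |stepDensity F (fun _ => n) x| ≤ S)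
    (hS' : ∀ x, |stepDensity F (fun _ => n + 1) x| ≤ S') :
    ‖pairing _ (measurable_stepDensity F fun _ => n + 1) S' hS'
      - pairing _ (measurable_stepDensity F fun _ => n) S hS‖ ≤ d * (2 * S' / 2 ^ n) := by
  have hnn : (0 : ℝ) ≤ d * (2 * S' / 2 ^ n) := by positivity
  refine ContinuousLinearMap.opNorm_le_bound _ hnn fun u => ?_
  have hrep : ∀ (N : Fin d → ℕ), ∫ x in unitCube d, stepDensity F N x * BV.toL1 u x
      = ∫ x, BV.toL1 u x * stepDensity F N x := by
    intro N
    simp_rw [mul_comm (stepDensity F N _)]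
    refine setIntegral_eq_integral_of_forall_compl_eq_zero fun x hx => ?_
    rw [stepDensity_of_notMem _ _ (fun h => hx (halfOpenCube_subset d h)), mul_zero]
  have hint := L1.integrable_coeFn (BV.toL1 u)
  rw [sub_apply, pairing_apply, pairing_apply, hrep, hrep, ← integral_sub
    (integrable_mul_of_bounded hint (measurable_stepDensity F _) hS')
    (integrable_mul_of_bounded hint (measurable_stepDensity F _) hS)]
  simp_rw [← mul_sub]
  refine (abs_integral_mul_stepDensity_succ_sub_le hint (BV.variation_lt_top u) hS0 hS').trans ?_
  refine mul_le_mul_of_nonneg_left ?_ hnn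
  rw [BV.norm_def]
  exact le_add_of_nonneg_left (norm_nonneg _)

theorem exists_tendsto_pairing_stepDensity {d : ℕ} {F : E d → ℝ} {C q : ℝ} (hC : 0 < C) (hq0 : 0 < q)
    (hq : q < 2) (hS : ∀ n x, |stepDensity F (fun _ => n) x| ≤ C * q ^ n) :
    ∃ α : StrongDual ℝ (BV d), Tendsto (fun n =>
      pairing _ (measurable_stepDensity F fun _ => n) (C * q ^ n) (hS n)) atTop (𝓝 α) := by
  -- With `S' = C * q ^ (n + 1)` the bound `d * (2 * S' / 2 ^ n)` equals `2 * d * C * q * (q / 2) ^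
  -- n`.
  refine cauchySeq_tendsto_of_complete (cauchySeq_of_le_geometric (q / 2) (2 * d * C * q)
    (by linarith) fun n => ?_)
  rw [dist_comm, dist_eq_norm]
  refine (norm_pairing_stepDensity_sub_le (by positivity) (hS n) (hS (n + 1))).trans (le_of_eq ?_)
  rw [div_pow, pow_succ]
  ring

/-! ### The charge of a function with Hölder increments -/

/-- A dyadic point of level `m` is a grid point of every level `n ≥ m`, so the sequence whose limit
is taken is eventually constant. -/
theorem chargeOf_box_grid {d : ℕ} {F : E d → ℝ} {M : ℝ} (hFM : ∀ x, |F x| ≤ M)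
    (hF0 : ∀ x, (∃ i, x i = 0) → F x = 0) {S : ℕ → ℝ}
    (hS : ∀ n x, |stepDensity F (fun _ => n) x| ≤ S n) {α : StrongDual ℝ (BV d)}
    (hα : Tendsto (fun n =>
      pairing _ (measurable_stepDensity F fun _ => n) (S n) (hS n)) atTop (𝓝 α))
    (m : ℕ) (k : Fin d → ℕ) (hk : ∀ i, k i ≤ 2 ^ m) :
    chargeOf α (box (fun _ => 0) fun i => (k i : ℝ) / 2 ^ m)
      = F (WithLp.toLp 2 fun i => (k i : ℝ) / 2 ^ m) := by
  have h2 : (0 : ℝ) < 2 ^ m := by positivity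
  have hB : IsBVSet (box (fun _ => 0) fun i : Fin d => (k i : ℝ) / 2 ^ m) :=
    isBVSet_box (fun _ => le_rfl) (fun i => by positivity)
      (fun i => by rw [div_le_one h2]; exact_mod_cast hk i)
  have hlim := ((ContinuousLinearMap.apply ℝ ℝ hB.indicator).continuous.tendsto α).comp hα
  rw [chargeOf_apply α hB]
  refine tendsto_nhds_unique hlim (tendsto_const_nhds.congr' ?_)
  filter_upwards [eventually_ge_atTop m] with n hn
  obtain ⟨l, rfl⟩ := Nat.exists_eq_add_of_le hn
  have hscale : ∀ i, (k i : ℝ) / 2 ^ m = ((k i * 2 ^ l : ℕ) : ℝ) / 2 ^ (m + l) := fun i => by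
    push_cast
    rw [pow_add, mul_div_mul_right _ _ (by positivity)]
  simp only [Function.comp, ContinuousLinearMap.apply_apply]
  rw [pairing_indicator _ _ hB (measurableSet_box _ _)]
  simp_rw [hscale]
  rw [integral_box_stepDensity hFM hF0]
  intro i
  rw [pow_add]
  exact Nat.mul_le_mul_right _ (hk i)

theorem tendsto_natFloor_two_pow_mul_div {t : ℝ} (ht : 0 ≤ t) :
    Tendsto (fun m : ℕ => (⌊2 ^ m * t⌋₊ : ℝ) / 2 ^ m) atTop (𝓝 t) := by
  have h := (tendsto_nat_floor_mul_div_atTop ht).comp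
    (tendsto_pow_atTop_atTop_of_one_lt (one_lt_two (α := ℝ)))
  refine h.congr fun m => ?_
  simp only [Function.comp, mul_comm]

theorem natFloor_two_pow_mul_div_le {t : ℝ} (ht : 0 ≤ t) (m : ℕ) :
    (⌊2 ^ m * t⌋₊ : ℝ) / 2 ^ m ≤ t := by
  rw [div_le_iff₀ (by positivity), mul_comm]
  exact Nat.floor_le (by positivity)

/-- A charge which agrees with a continuous function on dyadic boxes at the origin agrees with it
on all boxes at the origin. -/
theorem chargeOf_box_zero {d : ℕ} {F : E d → ℝ} (hF : ContinuousOn F (unitCube d))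
    {μ : Set (E d) → ℝ} (hμ : IsCharge μ)
    (hgrid : ∀ (m : ℕ) (k : Fin d → ℕ), (∀ i, k i ≤ 2 ^ m) →
      μ (box (fun _ => 0) fun i => (k i : ℝ) / 2 ^ m)
        = F (WithLp.toLp 2 fun i => (k i : ℝ) / 2 ^ m))
    (x : E d) (hx : x ∈ unitCube d) : μ (box (fun _ => 0) x) = F x := by
  -- Approximation from below makes the boxes subsets of the limit box, so that the symmetric
  -- difference is a difference of two products of side lengths. All perimeters are at most `2 * d`.
  set y : ℕ → Fin d → ℝ := fun m i => (⌊2 ^ m * x i⌋₊ : ℝ) / 2 ^ m with hy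
  have hy0 : ∀ m i, 0 ≤ y m i := fun m i => by positivity
  have hyx : ∀ m i, y m i ≤ x i := fun m i => natFloor_two_pow_mul_div_le (hx i).1 m
  have hylim : Tendsto y atTop (𝓝 x.ofLp) :=
    tendsto_pi_nhds.2 fun i => tendsto_natFloor_two_pow_mul_div (hx i).1
  have hval : ∀ m, μ (box (fun _ => 0) (y m)) = F (WithLp.toLp 2 (y m)) := fun m => by
    refine hgrid m (fun i => ⌊2 ^ m * x i⌋₊) fun i => ?_
    refine Nat.floor_le_of_le ?_
    push_cast
    exact mul_le_of_le_one_right (by positivity) (hx i).2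
  have hlimF : Tendsto (fun m => F (WithLp.toLp 2 (y m))) atTop (𝓝 (F x)) := by
    refine (hF x hx).tendsto.comp (tendsto_nhdsWithin_iff.2 ⟨?_, Eventually.of_forall fun m i =>
      ⟨hy0 m i, (hyx m i).trans (hx i).2⟩⟩)
    exact ((PiLp.continuous_toLp 2 _).tendsto x.ofLp).comp hylim
  refine tendsto_nhds_unique ?_ hlimF
  simp_rw [← hval]
  refine hμ.continuous _ _ (fun m => isBVSet_box (fun _ => le_rfl) (hy0 m)
    fun i => (hyx m i).trans (hx i).2) (isBVSet_box (fun _ => le_rfl) (fun i => (hx i).1)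
    fun i => (hx i).2) ?_ ?_
  · exact (iSup_le fun m => perimeter_box_le (fun _ => le_rfl) (hy0 m)
      fun i => (hyx m i).trans (hx i).2).trans_lt ENNReal.ofReal_lt_top
  · have hsub : ∀ m, box (fun _ => 0) (y m) ⊆ box (fun _ => 0) x.ofLp :=
      fun m z hz i => ⟨(hz i).1, (hz i).2.trans (hyx m i)⟩
    have hfin : ∀ p : Fin d → ℝ, volume (box (fun _ => 0) p) ≠ ∞ :=
      fun p => (isCompact_box _ _).measure_lt_top.ne
    have hvol : ∀ m, volume (symmDiff (box (fun _ => 0) (y m)) (box (fun _ => 0) x.ofLp))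
        = ENNReal.ofReal (∏ i, (x i - 0) - ∏ i, (y m i - 0)) := by
      intro m
      rw [symmDiff_of_le (hsub m), ← volume_real_box fun i => (hx i).1,
        ← volume_real_box (hy0 m), ← measureReal_sdiff (hsub m) (measurableSet_box _ _) (hfin x.ofLp),
        ofReal_measureReal ((measure_mono Set.sdiff_subset).trans_lt (hfin x.ofLp).lt_top).ne]
    simp_rw [hvol]
    have hp : Tendsto (fun m => ∏ i, (x i - 0) - ∏ i, (y m i - 0)) atTop
        (𝓝 (∏ i, (x i - 0) - ∏ i, (x i - 0))) :=
      tendsto_const_nhds.sub (tendsto_finsetProd _ fun i _ =>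
        ((tendsto_pi_nhds.1 hylim i).sub_const 0))
    rw [sub_self] at hp
    simpa using ENNReal.tendsto_ofReal hp

/-- The signed sum over corners in `increment` is inclusion-exclusion for boxes with a corner at the
origin; additivity then handles figures. -/
theorem extendsIncrement_chargeOf {d : ℕ} {F : E d → ℝ} {α : StrongDual ℝ (BV d)}
    (h : ∀ x ∈ unitCube d, chargeOf α (box (fun _ => 0) x) = F x) :
    ExtendsIncrement F (chargeOf α) := by
  intro m a b hr hd
  have hB : ∀ j, IsBVSet (box (a j) (b j)) := fun j =>
    isBVSet_box (fun i => (hr j i).1) (fun i => (hr j i).2.1.le) fun i => (hr j i).2.2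
  rw [chargeOf_iUnion α hB hd]
  refine Finset.sum_congr rfl fun j _ => ?_
  have hcorner : ∀ (s : Finset (Fin d)) (i : Fin d), 0 ≤ (if i ∈ s then a j i else b j i) ∧
      (if i ∈ s then a j i else b j i) ≤ 1 := by
    intro s i
    have := hr j i
    split_ifs
    · exact ⟨this.1, this.2.1.le.trans this.2.2⟩
    · exact ⟨this.1.trans this.2.1.le, this.2.2⟩
  rw [chargeOf_eq_sum α (fun s : Finset (Fin d) => (-1 : ℝ) ^ s.card)
    (B := fun s => box (fun _ => 0) (fun i => if i ∈ s then a j i else b j i))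
    (fun s => isBVSet_box (fun _ => le_rfl) (fun i => (hcorner s i).1) fun i => (hcorner s i).2)
    (hB j) (indicator_box_ae_eq (fun i => (hr j i).1) fun i => (hr j i).2.1.le)]
  refine Finset.sum_congr rfl fun s _ => ?_
  rw [← h (WithLp.toLp 2 fun i => if i ∈ s then a j i else b j i) (hcorner s)]

/-! ### Size of the step densities -/

theorem two_pow_pow_mul_rpow {d : ℕ} (γ : ℝ) (n : ℕ) :
    ((2 : ℝ) ^ n) ^ d * ((1 / 2 ^ n) ^ d) ^ γ = ((2 : ℝ) ^ ((d : ℝ) * (1 - γ))) ^ n := by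
  have h2 : (0 : ℝ) < 2 := two_pos
  have e1 : ((2 : ℝ) ^ n) ^ d = (2 : ℝ) ^ ((n : ℝ) * d) := by
    rw [Real.rpow_mul h2.le, Real.rpow_natCast, Real.rpow_natCast]
  rw [one_div, inv_pow, e1, ← Real.rpow_neg h2.le, ← Real.rpow_mul h2.le, ← Real.rpow_add h2,
    ← Real.rpow_natCast, ← Real.rpow_mul h2.le]
  congr 1
  ring

theorem increment_congr {d : ℕ} {f g : E d → ℝ} (hfg : ∀ x ∈ unitCube d, f x = g x)
    {a b : Fin d → ℝ} (ha : ∀ i, 0 ≤ a i ∧ a i ≤ 1) (hb : ∀ i, 0 ≤ b i ∧ b i ≤ 1) :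
    increment f a b = increment g a b := by
  refine Finset.sum_congr rfl fun s _ => ?_
  rw [hfg]
  intro i
  simp only
  split_ifs
  · exact ha i
  · exact hb i

theorem dyadicLower_mem {d : ℕ} (n : ℕ) (k : Fin d → Fin (2 ^ n)) (i : Fin d) :
    0 ≤ dyadicLower n k i ∧ dyadicLower n k i ≤ 1 := by
  have h2 : (0 : ℝ) < 2 ^ n := by positivity
  refine ⟨by unfold dyadicLower; positivity, ?_⟩
  rw [dyadicLower, div_le_one h2]
  exact_mod_cast (k i).2.le

theorem dyadicUpper_mem {d : ℕ} (n : ℕ) (k : Fin d → Fin (2 ^ n)) (i : Fin d) :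
    0 ≤ dyadicUpper n k i ∧ dyadicUpper n k i ≤ 1 := by
  have h2 : (0 : ℝ) < 2 ^ n := by positivity
  refine ⟨by unfold dyadicUpper; positivity, ?_⟩
  rw [dyadicUpper, div_le_one h2]
  exact_mod_cast (k i).2

theorem dyadicLower_lt_dyadicUpper {d : ℕ} (n : ℕ) (k : Fin d → Fin (2 ^ n)) (i : Fin d) :
    dyadicLower n k i < dyadicUpper n k i := by
  unfold dyadicLower dyadicUpper
  gcongr
  linarith

theorem volume_real_dyadicCube {d : ℕ} (n : ℕ) (k : Fin d → Fin (2 ^ n)) :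
    volume.real (dyadicCube n k) = (1 / 2 ^ n) ^ d := by
  rw [dyadicCube, volume_real_box fun i => (dyadicLower_lt_dyadicUpper n k i).le]
  have : ∀ i, dyadicUpper n k i - dyadicLower n k i = 1 / 2 ^ n := fun i => by
    unfold dyadicLower dyadicUpper
    ring
  simp_rw [this]
  simp

/-- When all meshes are equal the cells are dyadic cubes, and `|Δ_F(K)| / |K|` is at most `C
|K|^{γ-1}` with `|K| = 2^{-nd}`. -/
theorem abs_stepDensity_le_of_holder {d : ℕ} {F : E d → ℝ} {C γ : ℝ} (hC : 0 ≤ C)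
    (hF : ∀ (n : ℕ) (k : Fin d → Fin (2 ^ n)),
      |increment F (dyadicLower n k) (dyadicUpper n k)|
        ≤ C * (volume.real (dyadicCube n k)) ^ γ) (n : ℕ) (x : E d) :
    |stepDensity F (fun _ => n) x| ≤ C * ((2 : ℝ) ^ ((d : ℝ) * (1 - γ))) ^ n := by
  by_cases hx : x ∈ halfOpenCube d
  · have h2 : (0 : ℝ) < 2 ^ n := by positivity
    have hpos : ∀ i, 0 ≤ 2 ^ n * x i := fun i => mul_nonneg h2.le (hx i).1
    let k : Fin d → Fin (2 ^ n) := fun i => ⟨⌊2 ^ n * x i⌋₊, by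
      rw [Nat.floor_lt (hpos i)]
      push_cast
      exact mul_lt_of_lt_one_right h2 (hx i).2⟩
    have hfl : ∀ i, (⌊2 ^ n * x i⌋ : ℝ) = ((k i : ℕ) : ℝ) := fun i => by
      exact (natCast_floor_eq_intCast_floor (hpos i)).symm
    have e1 : gridLower (fun _ => n) x = dyadicLower n k := by
      funext i
      simp only [gridLower, dyadicLower, hfl]
    have e2 : gridUpper (fun _ => n) x = dyadicUpper n k := by
      funext i
      simp only [gridUpper, dyadicUpper, hfl]
    rw [stepDensity, Set.indicator_of_mem hx, e1, e2, Finset.prod_const, Finset.card_univ,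
      Fintype.card_fin, abs_mul, abs_of_pos (by positivity), ← two_pow_pow_mul_rpow, mul_left_comm]
    refine mul_le_mul_of_nonneg_left ?_ (by positivity)
    rw [← volume_real_dyadicCube n k]
    exact hF n k
  · rw [stepDensity_of_notMem _ _ hx, abs_zero]
    positivity

end StrongCharge

theorem mainTheorem10 (d : ℕ) (hd : 1 ≤ d) (γ : ℝ) (hγ : ((d : ℝ) - 1) / d < γ) (hγ1 : γ < 1)
    (f : StrongCharge.E d → ℝ) (hf : StrongCharge.MemC0 f) (C : ℝ) (hC : 0 ≤ C)
    (hinc : ∀ (n : ℕ) (k : Fin d → Fin (2 ^ n)),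
      |StrongCharge.increment f (StrongCharge.dyadicLower n k) (StrongCharge.dyadicUpper n k)|
        ≤ C * (MeasureTheory.volume.real (StrongCharge.dyadicCube n k)) ^ γ) :
    StrongCharge.IsHolderStronglyChargeable γ f := by
  open StrongCharge in
  -- Extension by zero gives a function that is bounded on all of `ℝ^d` and vanishes wherever some
  -- coordinate is `0`, as the integration of translates over the whole space requires. Increments
  -- inside the cube do not change.
  set F : E d → ℝ := (unitCube d).indicator f with hFdef
  have hFf : ∀ x ∈ unitCube d, F x = f x := fun x hx => Set.indicator_of_mem hx f
  have hF0 : ∀ x, (∃ i, x i = 0) → F x = 0 := by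
    intro x hx
    by_cases hxQ : x ∈ unitCube d
    · rw [hFf x hxQ, hf.2 x hxQ hx]
    · exact Set.indicator_of_notMem hxQ f
  obtain ⟨M, hM⟩ := (isCompact_box (fun _ : Fin d => (0 : ℝ)) (fun _ => 1)).exists_bound_of_continuousOn
    hf.1
  have hFM : ∀ x, |F x| ≤ max M 0 := by
    intro x
    by_cases hxQ : x ∈ unitCube d
    · rw [hFf x hxQ]; exact (hM x hxQ).trans (le_max_left _ _)
    · rw [hFdef, Set.indicator_of_notMem hxQ, abs_zero]; exact le_max_right _ _
  -- The constant `C + 1` is strictly positive, which the bound by a primitive needs; `C` itself may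
  -- be `0`.
  have hincF : ∀ (n : ℕ) (k : Fin d → Fin (2 ^ n)),
      |increment F (dyadicLower n k) (dyadicUpper n k)|
        ≤ (C + 1) * (volume.real (dyadicCube n k)) ^ γ := by
    intro n k
    rw [increment_congr hFf (dyadicLower_mem n k) (dyadicUpper_mem n k)]
    refine (hinc n k).trans (mul_le_mul_of_nonneg_right (by linarith) ?_)
    exact Real.rpow_nonneg measureReal_nonneg _
  have hS := abs_stepDensity_le_of_holder (by linarith : (0 : ℝ) ≤ C + 1) hincF
  have hd0 : (0 : ℝ) < d := by exact_mod_cast hd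
  -- The lower bound on `γ` enters here, as `d * (1 - γ) < 1`.
  have hq : (2 : ℝ) ^ ((d : ℝ) * (1 - γ)) < 2 := by
    rw [div_lt_iff₀ hd0] at hγ
    calc (2 : ℝ) ^ ((d : ℝ) * (1 - γ)) < (2 : ℝ) ^ (1 : ℝ) :=
          Real.rpow_lt_rpow_of_exponent_lt one_lt_two (by linarith)
      _ = 2 := Real.rpow_one 2
  obtain ⟨α, hα⟩ := exists_tendsto_pairing_stepDensity (by linarith : (0 : ℝ) < C + 1)
    (by positivity) hq hS
  have hcharge : IsCharge (chargeOf α) := isCharge_chargeOf fun ε hε => by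
    obtain ⟨n, hn⟩ := (hα.eventually (Metric.ball_mem_nhds α hε)).exists
    rw [dist_comm, dist_eq_norm] at hn
    exact ⟨_, _, _, _, hn⟩
  have hSCH : α ∈ SCH d :=
    mem_closure_of_tendsto hα (Eventually.of_forall fun n => pairing_mem_rangeT _ _)
  have hext : ExtendsIncrement f (chargeOf α) := by
    refine extendsIncrement_chargeOf fun x hx => ?_
    refine chargeOf_box_zero hf.1 hcharge (fun m k hk => ?_) x hx
    rw [chargeOf_box_grid hFM hF0 hS hα m k hk]
    refine hFf _ fun i => ⟨by simp only; positivity, ?_⟩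
    simp only
    rw [div_le_one (by positivity)]
    exact_mod_cast hk i
  refine ⟨chargeOf α, ⟨⟨hcharge, α, hSCH, fun B hB => chargeOf_apply α hB⟩, hext⟩, C, hC,
    fun n k => ?_⟩
  -- A dyadic cube is a figure made of one rectangle, so the Hölder bound is the hypothesis on `f`,
  -- with the original constant `C`.
  have h1 := hext 1 (fun _ => dyadicLower n k) (fun _ => dyadicUpper n k)
    (fun _ i => ⟨(dyadicLower_mem n k i).1, dyadicLower_lt_dyadicUpper n k i,
      (dyadicUpper_mem n k i).2⟩) (fun j l hjl => absurd (Subsingleton.elim j l) hjl)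
  simp only [Set.iUnion_const, Finset.sum_const, Finset.card_univ, Fintype.card_fin, one_smul] at h1
  rw [dyadicCube, h1]
  exact hinc n k
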